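/- **Theorem 2.** Let $0<\lambda<1$ and $b_1,b_2,c>0$, put $a=\sqrt{b_1^2+b_2^2}$ and $$\mathbf a=(a,0,0),\quad \mathbf b=(b_1,b_2,0),\quad \mathbf c=\lambda\mathbf b+(0,0,c),\quad \mathbf d=\lambda\mathbf a-(0,0,c),$$ let $T=\operatorname{conv}(\mathbf 0,\mathbf a,\mathbf b,\mathbf a+\mathbf b,\mathbf c,\mathbf a+\mathbf c,\mathbf d,\mathbf b+\mathbf d)$ be the SCD tile, $\Gamma=\mathbb Z\mathbf a+\mathbb Z\mathbf b$, and let $R$ be the rotation about $\mathbb R\mathbf e_3$ through $-\varphi$, where $\varphi=\arctan(b_2/b_1)$ is the angle between $\mathbf a$ and $\mathbf b$ (so $R\mathbf b=\mathbf a$). An SCD tiling is a tiling $$\mathcal T=\bigcup_{m\in\mathbb Z}\ \{\,m(0,0,c)+\mathbf v_m+R^m(\mathbf x-\mathbf c)+R^mT \;:\; \mathbf x\in\Gamma\,\},$$ where each $\mathbf v_m$ lies in the plane $x_3=0$ and $\mathbf v_{m+1}-\mathbf v_m$ is a real multiple of $R^m\mathbf a$ (the common direction of the ridges and valleys in which layers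 $m$ and $m+1$ meet). Choose $\mathbf z$ in the interior of $T$; the SCD set $\Lambda_{\mathrm{SCD}}$ is obtained from $\mathcal T$ by replacing each tile $\mathbf w+R^mT$ of layer $m$ by the point $\mathbf w+R^m\mathbf z$. Let $C_r=[-r/2,r/2]^3$, and let $\gamma$ be an autocorrelation of $\Lambda_{\mathrm{SCD}}$, i.e. a (locally finite, positive) measure that is the vague limit of $$r^{-3}\sum_{\mathbf x,\mathbf y\in\Lambda_{\mathrm{SCD}}\cap C_r}\delta_{\mathbf x-\mathbf y}$$ along some sequence of radii $r\to\infty$. Let $\operatorname{dens}^{(n)}(S)=\lim_{r\to\infty} r^{-n}\,\#(S\cap[-r/2,r/2]^n)$ denote $n$-dimensional density. Then the densities $\operatorname{dens}^{(2)}(\Gamma)>0$ and $\operatorname{dens}^{(3)}(\Lambda_{\mathrm{SCD}})=c^{-1}\operatorname{dens}^{(2)}(\Gamma)$ exist, the Fourier transform $\widehat\gamma$ of $\gamma$ (as a tempered distribution) is a positive measure, and its restriction to the axis $\mathbb R\mathbf e_3$ is pure point. Explicitly, $$\widehat\gamma\,\big|_{\mathbb R\mathbf e_3}=c^{-1}\operatorname{dens}^{(2)}(\Gamma)\,\operatorname{dens}^{(3)}(\Lambda_{\mathrm{SCD}})\sum_{\mathbf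 x\in c^{-1}\mathbb Z\mathbf e_3}\delta_{\mathbf x} =\bigl(\operatorname{dens}^{(3)}(\Lambda_{\mathrm{SCD}})\bigr)^2\sum_{\mathbf x\in c^{-1}\mathbb Z\mathbf e_3}\delta_{\mathbf x},$$ a comb of Bragg peaks on the uniformly discrete set $c^{-1}\mathbb Z\mathbf e_3$. -/

import Mathlib

open MeasureTheory Filter Topology
open scoped FourierTransform SchwartzMap ENNReal NNReal

/-! ### Euclidean space, cubes, densities, pure point measures -/

/-- Euclidean 3-space. -/
abbrev E3 : Type := EuclideanSpace ℝ (Fin 3)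

/-- Euclidean plane. -/
abbrev E2 : Type := EuclideanSpace ℝ (Fin 2)

/-- The closed cube `[-r/2, r/2]^n` of side length `r` centred at the origin. -/
def centredCube (n : ℕ) (r : ℝ) : Set (EuclideanSpace ℝ (Fin n)) :=
  {x | ∀ i, |x i| ≤ r / 2}

/-- The point set `S` in `ℝ^n` is locally finite and has `n`-dimensional density `d`. -/
def HasDensity (n : ℕ) (S : Set (EuclideanSpace ℝ (Fin n))) (d : ℝ) : Prop :=
  (∀ r : ℝ, (S ∩ centredCube n r).Finite) ∧
    Tendsto (fun r : ℝ => ((S ∩ centredCube n r).ncard : ℝ) / r ^ n) atTop (𝓝 d)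

/-- The Dirac comb `δ_S = ∑_{x ∈ S} δ_x`. -/
noncomputable def diracComb (S : Set E3) : Measure E3 :=
  Measure.sum fun x : S => Measure.dirac (x : E3)

/-- A measure is pure point if it is a sum of weighted Dirac measures over a countable set. -/
def IsPurePoint (μ : Measure E3) : Prop :=
  ∃ (S : Set E3) (I : E3 → ℝ≥0∞), S.Countable ∧
    μ = Measure.sum fun x : S => I x • Measure.dirac (x : E3)

/-- A set is uniformly discrete if its points keep a common positive distance. -/
def IsUniformlyDiscrete (S : Set E3) : Prop :=
  ∃ ε : ℝ, 0 < ε ∧ ∀ x ∈ S, ∀ y ∈ S, x ≠ y → ε ≤ dist x y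

/-! ### SCD tiles, SCD tilings and SCD sets -/

/-- The parameters of an SCD tile. -/
structure SCDParams where
  /-- the shear parameter `λ` -/
  lam : ℝ
  /-- first coordinate of the vector `b` -/
  b₁ : ℝ
  /-- second coordinate of the vector `b` -/
  b₂ : ℝ
  /-- height parameter -/
  c : ℝ
  lam_pos : 0 < lam
  lam_lt_one : lam < 1
  b₁_pos : 0 < b₁
  b₂_pos : 0 < b₂
  c_pos : 0 < c

namespace SCDParams

variable (P : SCDParams)

/-- The vector `(0, 0, c)`. -/
noncomputable def height : E3 := !₂[0, 0, P.c]

/-- The vector `a = (√(b₁² + b₂²), 0, 0)`. -/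
noncomputable def aVec : E3 := !₂[√(P.b₁ ^ 2 + P.b₂ ^ 2), 0, 0]

/-- The vector `b = (b₁, b₂, 0)`. -/
noncomputable def bVec : E3 := !₂[P.b₁, P.b₂, 0]

/-- The vector `λ b + (0, 0, c)`. -/
noncomputable def cVec : E3 := P.lam • P.bVec + P.height

/-- The vector `d = λ a - (0, 0, c)`. -/
noncomputable def dVec : E3 := P.lam • P.aVec - P.height

/-- The SCD tile. -/
noncomputable def tile : Set E3 :=
  convexHull ℝ {0, P.aVec, P.bVec, P.aVec + P.bVec, P.cVec, P.aVec + P.cVec,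
    P.dVec, P.bVec + P.dVec}

/-- The lattice `Γ = ℤ a + ℤ b`, as a subset of the plane `x₃ = 0` of `ℝ³`. -/
def lattice : Set E3 := {x | ∃ i j : ℤ, x = i • P.aVec + j • P.bVec}

/-- The lattice `Γ` as a subset of `ℝ²`. -/
def planarLattice : Set E2 := {x | (!₂[x 0, x 1, 0] : E3) ∈ P.lattice}

/-- The angle `φ` between `a` and `b`. -/
noncomputable def angle : ℝ := Real.arctan (P.b₂ / P.b₁)

/-- `R ^ m`, where `R` is the rotation through `-φ` around the third coordinate axis;
it satisfies `R b = a`. -/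
noncomputable def rotPow (m : ℤ) (x : E3) : E3 :=
  let θ : ℝ := m * (-P.angle)
  !₂[Real.cos θ * x 0 - Real.sin θ * x 1, Real.sin θ * x 0 + Real.cos θ * x 1, x 2]

/-- The admissible horizontal shifts `v m` of the layers: consecutive layers may be shifted
against each other along the ridges and valleys in which they meet. The ridges and valleys on top
of layer `m` have the direction of `R ^ m a = R ^ (m + 1) b`, as have those at the bottom of
layer `m + 1`. -/
def IsShift (v : ℤ → E3) : Prop :=
  (∀ m, v m 2 = 0) ∧ ∀ m, ∃ t : ℝ, v (m + 1) - v m = t • P.rotPow m P.aVec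

/-- The pairs `(m, w)` such that `w + R ^ m T` is a tile of layer `m` of the tiling
`⋃ m, m (0, 0, c) + v m + R ^ m L'` with `L' = {x + T | x ∈ Γ} - (λ b + (0, 0, c))`. -/
def placements (v : ℤ → E3) : Set (ℤ × E3) :=
  {p | ∃ x ∈ P.lattice, p.2 = p.1 • P.height + v p.1 + P.rotPow p.1 (x - P.cVec)}

/-- The SCD tiling with shifts `v`, as a collection of tiles. -/
def scdTiling (v : ℤ → E3) : Set (Set E3) :=
  {U | ∃ p ∈ P.placements v, U = (fun y => p.2 + P.rotPow p.1 y) '' P.tile}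

/-- The SCD set: each tile `w + R ^ m T` of the tiling is replaced by its reference point
`w + R ^ m z`. -/
def scdSet (v : ℤ → E3) (z : E3) : Set E3 :=
  {y | ∃ p ∈ P.placements v, y = p.2 + P.rotPow p.1 z}

/-- The third coordinate axis `ℝ e₃`. -/
def axis : Set E3 := {x | x 0 = 0 ∧ x 1 = 0}

/-- The set `c⁻¹ ℤ e₃`. -/
noncomputable def axisPoints : Set E3 := Set.range fun n : ℤ => (!₂[0, 0, P.c⁻¹ * n] : E3)

end SCDParams

/-! ### Autocorrelation and diffraction -/

/-- The measure `r⁻³ ∑_{x, y ∈ Λ ∩ C_r} δ_{x - y}`. -/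
noncomputable def approxAutocorrelation (Λ : Set E3) (r : ℝ) : Measure E3 :=
  ENNReal.ofReal ((r ^ 3)⁻¹) •
    Measure.sum fun p : ↥(Λ ∩ centredCube 3 r) × ↥(Λ ∩ centredCube 3 r) =>
      Measure.dirac ((p.1 : E3) - (p.2 : E3))

/-- `γ` is the autocorrelation of `Λ` along the radii `r k → ∞`: a Radon measure that is the vague
limit of the measures `(r k)⁻³ ∑_{x, y ∈ Λ ∩ C_{r k}} δ_{x - y}`. -/
def IsAutocorrelation (Λ : Set E3) (r : ℕ → ℝ) (γ : Measure E3) : Prop :=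
  Tendsto r atTop atTop ∧ IsLocallyFiniteMeasure γ ∧
    ∀ f : E3 → ℝ, Continuous f → HasCompactSupport f →
      Tendsto (fun k => ∫ x, f x ∂(approxAutocorrelation Λ (r k))) atTop (𝓝 (∫ x, f x ∂γ))

/-- The positive measure `μ` is the Fourier transform of the positive measure `γ`, in the sense of
tempered distributions. -/
def IsFourierTransformOf (μ γ : Measure E3) : Prop :=
  ∃ (_ : γ.HasTemperateGrowth) (_ : μ.HasTemperateGrowth),
    𝓕 (γ.toTemperedDistribution) = μ.toTemperedDistribution

/-!
An SCD set `Λ` consists of equally spaced horizontal layers, and each layer is a translate of a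
rotated copy of the planar lattice `Γ`. The rotations make the horizontal order incoherent from
layer to layer, but they preserve the covolume of the lattice, and the vertical positions are those
of a coset of `c ℤ`. Both features are visible in one object: a map `ρ` that sends each point of
space to the point of `Λ` whose cell contains it, by rounding down first the height and then the
lattice coordinates in the layer so found. All cells have the same volume `V = a b₂ c` and uniformly
bounded extent, so a sum over `Λ` is `V⁻¹` times an integral of the summand composed with `ρ`
(`IsCellMap.integral_count`). This gives the densities (`IsCellMap.hasDensity`) and bounds for
lattice-like sums that are uniform over all translates (`IsCellMap.exists_integral_polyWeight_le`).

The Fourier transform of an autocorrelation `γ` is a limit of the diffraction measures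
`r⁻³ |∑ exp(-2πi ξ·x)|² dξ` of the finite pieces of `Λ`. Testing with wide Gaussians bounds
the masses of balls under these measures polynomially (`finiteDiffraction_closedBall_le`), and
Prokhorov's theorem, applied after multiplication by a decaying weight, gives a limit measure
(`exists_limit_measure`, `IsCellMap.exists_fourierTransform`).

For the restriction of `μ = γ̂` to the axis, one integrates `g(x₀/ε) g(x₁/ε) ψ(x₂)` against `μ`,
where `g(0) = 1`; as `ε → 0` this tends to the integral of `ψ(x₂)` over the axis
(`tendsto_integral_axis`). On the other side, `γ` is tested with a Fourier transform that is
spread out horizontally on the scale `1/ε`. Its sum over `Λ - y`, for any `y ∈ Λ`, sees only the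
density of each layer, not the direction of its lattice, so up to `O(ε)` it is `V⁻¹` times the
integral of the vertical factor sampled at the multiples of `c`
(`IsCellMap.exists_norm_integral_layerKernel_sub_le`). Poisson summation turns this into
`V⁻¹ ∑ ψ(n/c)` (`integral_fourier_mul_floor`), and averaging over `y` contributes the second factor
`V⁻¹` (`IsCellMap.norm_integral_autocorrelation_sub_le`). Hence `μ` and the comb
`V⁻² ∑ δ_{n/c}` have the same integrals of all test functions `ψ` along the axis
(`IsCellMap.integral_axis_eq`), and these determine the restriction
(`IsCellMap.restrict_axis_eq`).
-/

/-! ### Cell maps and densities -/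

/-- A cell map of a countable set `S ⊆ ℝ^n`: every point `p` is sent to the point `ρ p` of `S`
that owns the cell containing `p`. The cells, i.e. the fibres of `ρ`, all have volume `V`, and a
cell stays within distance `D` of its owner in every coordinate. The condition on the volumes
is encoded as: the push-forward of Lebesgue measure is `V` times the counting measure of `S`. -/
structure IsCellMap {n : ℕ} (S : Set (EuclideanSpace ℝ (Fin n))) (V D : ℝ)
    (ρ : EuclideanSpace ℝ (Fin n) → EuclideanSpace ℝ (Fin n)) : Prop where
  volume_pos : 0 < V
  countable : S.Countable
  measurable : Measurable ρ
  abs_sub_le : ∀ p i, |ρ p i - p i| ≤ D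
  map_volume : (volume : Measure (EuclideanSpace ℝ (Fin n))).map ρ =
    ENNReal.ofReal V • Measure.count.restrict S

/-- For a map into `S`, the conditions on measurability and on volumes can be checked on the
individual cells. -/
lemma IsCellMap.of_fibers {n : ℕ} {S : Set (EuclideanSpace ℝ (Fin n))} {V D : ℝ}
    {ρ : EuclideanSpace ℝ (Fin n) → EuclideanSpace ℝ (Fin n)} (hV : 0 < V) (hS : S.Countable)
    (hmem : ∀ p, ρ p ∈ S) (hD : ∀ p i, |ρ p i - p i| ≤ D)
    (hmeas : ∀ x ∈ S, MeasurableSet (ρ ⁻¹' {x}))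
    (hvol : ∀ x ∈ S, volume (ρ ⁻¹' {x}) = ENNReal.ofReal V) :
    IsCellMap S V D ρ := by
  have hpre : ∀ B : Set (EuclideanSpace ℝ (Fin n)), ρ ⁻¹' B = ρ ⁻¹' (B ∩ S) := by
    intro B
    ext p
    simp [hmem p]
  have hm : Measurable ρ := by
    intro B _
    rw [hpre, ← Set.biUnion_preimage_singleton]
    exact MeasurableSet.biUnion (hS.mono Set.inter_subset_right) fun x hx => hmeas x hx.2
  refine ⟨hV, hS, hm, hD, ?_⟩
  ext B hB
  rw [Measure.map_apply hm hB, hpre, Measure.smul_apply, Measure.restrict_apply hB,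
    ← tsum_measure_preimage_singleton (hS.mono Set.inter_subset_right) fun y hy => hmeas y hy.2]
  rw [tsum_congr (fun b : ↥(B ∩ S) => hvol b b.2.2), ENNReal.tsum_const,
    Measure.count_apply (hB.inter hS.measurableSet), mul_comm]
  rfl

lemma measurableSet_centredCube (n : ℕ) (r : ℝ) : MeasurableSet (centredCube n r) := by
  have : centredCube n r = ⋂ i, {x | |x i| ≤ r / 2} := by
    ext x; simp [centredCube]
  rw [this]
  refine MeasurableSet.iInter fun i => measurableSet_le ?_ measurable_const
  fun_prop

lemma volume_centredCube (n : ℕ) {r : ℝ} (hr : 0 ≤ r) :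
    volume (centredCube n r) = ENNReal.ofReal (r ^ n) := by
  have h : centredCube n r = (WithLp.ofLp : EuclideanSpace ℝ (Fin n) → _) ⁻¹'
      (Set.univ.pi fun _ => Set.Icc (-(r / 2)) (r / 2)) := by
    ext x; simp [centredCube, abs_le, Pi.le_def, forall_and]
  rw [h, (PiLp.volume_preserving_ofLp (Fin n)).measure_preimage
    (MeasurableSet.univ_pi fun _ => measurableSet_Icc).nullMeasurableSet, Set.pi_univ_Icc,
    Real.volume_Icc_pi]
  simp only [sub_neg_eq_add, add_halves, Finset.prod_const, Finset.card_univ, Fintype.card_fin]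
  rw [ENNReal.ofReal_pow hr]

/-- Volume of the half-open parallelepiped `{p | (M p + w) i ∈ [k i, k i + 1) for all i}`. -/
lemma volume_parallelepiped {n : ℕ} {M : Matrix (Fin n) (Fin n) ℝ} (hM : M.det ≠ 0)
    (w k : Fin n → ℝ) :
    MeasurableSet {p : EuclideanSpace ℝ (Fin n) |
      ∀ i, M.mulVec p.ofLp i + w i ∈ Set.Ico (k i) (k i + 1)} ∧
    volume {p : EuclideanSpace ℝ (Fin n) |
      ∀ i, M.mulVec p.ofLp i + w i ∈ Set.Ico (k i) (k i + 1)} = ENNReal.ofReal |M.det⁻¹| := by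
  have h : {p : EuclideanSpace ℝ (Fin n) |
      ∀ i, M.mulVec p.ofLp i + w i ∈ Set.Ico (k i) (k i + 1)} =
      (WithLp.ofLp : EuclideanSpace ℝ (Fin n) → _) ⁻¹' ((Matrix.toLin' M) ⁻¹'
      (Set.univ.pi fun i => Set.Ico (k i - w i) (k i - w i + 1))) := by
    ext x
    simp only [Set.mem_ofPred_eq, Set.mem_preimage, Set.mem_univ_pi, Matrix.toLin'_apply,
      Set.mem_Ico]
    refine forall_congr' fun i => ⟨fun h => ⟨?_, ?_⟩, fun h => ⟨?_, ?_⟩⟩ <;>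
      linarith [h.1, h.2]
  have hbox : MeasurableSet (Set.univ.pi fun i => Set.Ico (k i - w i) (k i - w i + 1)) :=
    MeasurableSet.univ_pi fun _ => measurableSet_Ico
  have hlin : Measurable (Matrix.toLin' M) :=
    (LinearMap.continuous_of_finiteDimensional _).measurable
  rw [h]
  refine ⟨(WithLp.measurable_ofLp 2 (Fin n → ℝ)) (hlin hbox), ?_⟩
  rw [(PiLp.volume_preserving_ofLp (Fin n)).measure_preimage (hlin hbox).nullMeasurableSet,
    ← Measure.map_apply hlin hbox, Real.map_matrix_volume_pi_eq_smul_volume_pi hM,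
    Measure.smul_apply, Real.volume_pi_Ico]
  simp

namespace IsCellMap

variable {n : ℕ} {S : Set (EuclideanSpace ℝ (Fin n))} {V D : ℝ}
  {ρ : EuclideanSpace ℝ (Fin n) → EuclideanSpace ℝ (Fin n)}

lemma diam_nonneg (h : IsCellMap S V D ρ) (i : Fin n) : 0 ≤ D :=
  (abs_nonneg _).trans (h.abs_sub_le 0 i)

lemma volume_preimage_centredCube (h : IsCellMap S V D ρ) (r : ℝ) :
    volume (ρ ⁻¹' centredCube n r) = ENNReal.ofReal V * (S ∩ centredCube n r).encard := by
  rw [← Measure.map_apply h.measurable (measurableSet_centredCube n r), h.map_volume,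
    Measure.smul_apply, Measure.restrict_apply (measurableSet_centredCube n r), Set.inter_comm,
    Measure.count_apply (h.countable.measurableSet.inter (measurableSet_centredCube n r))]
  rfl

lemma preimage_centredCube_subset (h : IsCellMap S V D ρ) (r : ℝ) :
    ρ ⁻¹' centredCube n r ⊆ centredCube n (r + 2 * D) := by
  intro p hp i
  have h1 := hp i
  have h2 := h.abs_sub_le p i
  rw [abs_le] at *
  constructor <;> linarith

lemma centredCube_subset_preimage (h : IsCellMap S V D ρ) (r : ℝ) :
    centredCube n (r - 2 * D) ⊆ ρ ⁻¹' centredCube n r := by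
  intro p hp i
  have h1 := hp i
  have h2 := h.abs_sub_le p i
  rw [abs_le] at *
  constructor <;> linarith

lemma finite_inter_centredCube (h : IsCellMap S V D ρ) (r : ℝ) :
    (S ∩ centredCube n r).Finite := by
  rw [← Set.encard_ne_top_iff]
  intro htop
  have h1 := h.volume_preimage_centredCube r
  have h2 : volume (ρ ⁻¹' centredCube n r) ≤ volume (centredCube n |r + 2 * D|) :=
    measure_mono ((h.preimage_centredCube_subset r).trans fun x hx i =>
      (hx i).trans (by linarith [le_abs_self (r + 2 * D)]))
  rw [volume_centredCube n (abs_nonneg _), h1, htop] at h2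
  have hV : ENNReal.ofReal V ≠ 0 := by simpa using h.volume_pos
  simp [ENNReal.mul_top hV] at h2

lemma mul_ncard_le (h : IsCellMap S V D ρ) {r : ℝ} (hr : 0 ≤ r + 2 * D) :
    V * (S ∩ centredCube n r).ncard ≤ (r + 2 * D) ^ n := by
  have h1 := h.volume_preimage_centredCube r
  have h2 := measure_mono (μ := volume) (h.preimage_centredCube_subset r)
  rw [volume_centredCube n hr, h1, ← (h.finite_inter_centredCube r).cast_ncard_eq] at h2
  rw [← ENNReal.ofReal_le_ofReal_iff (pow_nonneg hr n), ENNReal.ofReal_mul h.volume_pos.le,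
    ENNReal.ofReal_natCast]
  exact h2

lemma le_mul_ncard (h : IsCellMap S V D ρ) {r : ℝ} (hr : 0 ≤ r - 2 * D) :
    (r - 2 * D) ^ n ≤ V * (S ∩ centredCube n r).ncard := by
  have h1 := h.volume_preimage_centredCube r
  have h2 := measure_mono (μ := volume) (h.centredCube_subset_preimage r)
  rw [volume_centredCube n hr, h1, ← (h.finite_inter_centredCube r).cast_ncard_eq] at h2
  rw [← ENNReal.ofReal_le_ofReal_iff (mul_nonneg h.volume_pos.le (Nat.cast_nonneg _)),
    ENNReal.ofReal_mul h.volume_pos.le, ENNReal.ofReal_natCast]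
  exact h2

end IsCellMap

lemma tendsto_add_pow_div_pow (n : ℕ) (s : ℝ) :
    Tendsto (fun r : ℝ => (r + s) ^ n / r ^ n) atTop (𝓝 1) := by
  have h1 : Tendsto (fun r : ℝ => 1 + s * r⁻¹) atTop (𝓝 (1 + s * 0)) :=
    tendsto_const_nhds.add (tendsto_inv_atTop_zero.const_mul s)
  have h2 := h1.pow n
  simp only [mul_zero, add_zero, one_pow] at h2
  refine h2.congr' ?_
  filter_upwards [eventually_gt_atTop 0] with r hr
  rw [← div_pow]
  congr 1
  field_simp

namespace IsCellMap

variable {n : ℕ} {S : Set (EuclideanSpace ℝ (Fin n))} {V D : ℝ}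
  {ρ : EuclideanSpace ℝ (Fin n) → EuclideanSpace ℝ (Fin n)}

/-- Counting the points of `S` in a cube with a collar of constant width `s` removed gives the
same density. -/
lemma tendsto_ncard_sub (h : IsCellMap S V D ρ) (s : ℝ) :
    Tendsto (fun r : ℝ => ((S ∩ centredCube n (r - s)).ncard : ℝ) / r ^ n) atTop (𝓝 V⁻¹) := by
  have hV := h.volume_pos
  have hlo := (tendsto_add_pow_div_pow n (-s - 2 * D)).const_mul V⁻¹
  have hhi := (tendsto_add_pow_div_pow n (-s + 2 * D)).const_mul V⁻¹
  rw [mul_one] at hlo hhi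
  refine tendsto_of_tendsto_of_tendsto_of_le_of_le' hlo hhi ?_ ?_
  · filter_upwards [eventually_gt_atTop 0, eventually_ge_atTop (s + 2 * D)] with r hr hr'
    have := h.le_mul_ncard (r := r - s) (by linarith)
    rw [show r - s - 2 * D = r + (-s - 2 * D) by ring] at this
    rw [← mul_div_assoc]
    gcongr
    rwa [inv_mul_le_iff₀ hV]
  · filter_upwards [eventually_gt_atTop 0, eventually_ge_atTop (s - 2 * D)] with r hr hr'
    have := h.mul_ncard_le (r := r - s) (by linarith)
    rw [show r - s + 2 * D = r + (-s + 2 * D) by ring] at this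
    rw [← mul_div_assoc]
    gcongr
    rwa [le_inv_mul_iff₀ hV]

lemma hasDensity (h : IsCellMap S V D ρ) : HasDensity n S V⁻¹ :=
  ⟨h.finite_inter_centredCube, by simpa using h.tendsto_ncard_sub 0⟩

end IsCellMap

/-! ### Cell maps of the planar lattice and of SCD sets -/

namespace SCDParams

/-- The common length of the vectors `a` and `b`. -/
noncomputable def aLen (P : SCDParams) : ℝ := √(P.b₁ ^ 2 + P.b₂ ^ 2)

lemma aLen_pos (P : SCDParams) : 0 < P.aLen :=
  Real.sqrt_pos.2 (by have := P.b₁_pos; positivity)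

/-- The bound for the extent of a lattice cell in each coordinate direction. -/
noncomputable def cellDiam (P : SCDParams) : ℝ := P.aLen + P.b₁ + P.b₂ + P.c

lemma abs_floor_sub_le_one (x : ℝ) : |(⌊x⌋ : ℝ) - x| ≤ 1 := by
  rw [abs_le]
  constructor <;> linarith [Int.floor_le x, Int.lt_floor_add_one x]

/-- The cell map of the planar lattice, by rounding down the coordinates with respect to the
basis `a, b`. -/
noncomputable def planarCell (P : SCDParams) (p : E2) : E2 :=
  !₂[⌊(p 0 - P.b₁ * (p 1 / P.b₂)) / P.aLen⌋ * P.aLen + ⌊p 1 / P.b₂⌋ * P.b₁,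
    ⌊p 1 / P.b₂⌋ * P.b₂]

lemma mem_planarLattice_iff (P : SCDParams) (x : E2) :
    x ∈ P.planarLattice ↔ ∃ i j : ℤ, x = !₂[i * P.aLen + j * P.b₁, j * P.b₂] := by
  simp only [planarLattice, lattice, Set.mem_ofPred_eq]
  refine exists_congr fun i => exists_congr fun j => ⟨fun h => ?_, fun h => ?_⟩
  · have h0 := congrArg (fun y : E3 => y 0) h
    have h1 := congrArg (fun y : E3 => y 1) h
    simp [aVec, bVec] at h0 h1
    ext k
    fin_cases k <;> simp [h0, h1, aLen]
  · subst h
    ext k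
    fin_cases k <;> simp [aVec, bVec, aLen]

lemma isCellMap_planarCell (P : SCDParams) :
    IsCellMap P.planarLattice (P.aLen * P.b₂) P.cellDiam P.planarCell := by
  have ha := P.aLen_pos
  have hb₁ := P.b₁_pos
  have hb := P.b₂_pos
  have hc := P.c_pos
  let M : Matrix (Fin 2) (Fin 2) ℝ := !![1 / P.aLen, - P.b₁ / (P.aLen * P.b₂); 0, 1 / P.b₂]
  have hdet : M.det = 1 / (P.aLen * P.b₂) := by
    simp [M, Matrix.det_fin_two]
    field_simp
  have hdet0 : M.det ≠ 0 := by rw [hdet]; positivity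
  have hfib : ∀ i j : ℤ, P.planarCell ⁻¹' {!₂[i * P.aLen + j * P.b₁, j * P.b₂]} =
      {p : E2 | ∀ l, M.mulVec p.ofLp l + (0 : Fin 2 → ℝ) l ∈
        Set.Ico ((![(i : ℝ), j] : Fin 2 → ℝ) l) ((![(i : ℝ), j] : Fin 2 → ℝ) l + 1)} := by
    intro i j
    ext p
    have h0 : M.mulVec p.ofLp 0 = (p 0 - P.b₁ * (p 1 / P.b₂)) / P.aLen := by
      simp [M, Matrix.mulVec, dotProduct, Fin.sum_univ_two]
      field_simp
      ring
    have h1 : M.mulVec p.ofLp 1 = p 1 / P.b₂ := by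
      simp [M, Matrix.mulVec, dotProduct, Fin.sum_univ_two]
      field_simp
    simp only [Set.mem_preimage, Set.mem_singleton_iff, Set.mem_ofPred_eq, Fin.forall_fin_two,
      h0, h1, Pi.zero_apply, add_zero, Matrix.cons_val_zero, Matrix.cons_val_one, Set.mem_Ico,
      ← Int.floor_eq_iff]
    constructor
    · intro h
      have e0 := congrArg (fun y : E2 => y 0) h
      have e1 := congrArg (fun y : E2 => y 1) h
      simp [planarCell, hb.ne'] at e0 e1
      rw [e1] at e0
      refine ⟨?_, e1⟩
      have : (⌊(p 0 - P.b₁ * (p 1 / P.b₂)) / P.aLen⌋ : ℝ) = i :=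
        mul_right_cancel₀ ha.ne' (by linarith)
      exact_mod_cast this
    · rintro ⟨h, h'⟩
      rw [planarCell, h, h']
  refine IsCellMap.of_fibers (by positivity) ?_ ?_ ?_ ?_ ?_
  · have : P.planarLattice =
        Set.range fun q : ℤ × ℤ => (!₂[q.1 * P.aLen + q.2 * P.b₁, q.2 * P.b₂] : E2) := by
      ext x
      rw [mem_planarLattice_iff]
      simp [eq_comm]
    rw [this]
    exact Set.countable_range _
  · exact fun p => (P.mem_planarLattice_iff _).2 ⟨_, _, rfl⟩
  · intro p l
    have hS := abs_floor_sub_le_one ((p 0 - P.b₁ * (p 1 / P.b₂)) / P.aLen)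
    have hT := abs_floor_sub_le_one (p 1 / P.b₂)
    have eT : p 1 = p 1 / P.b₂ * P.b₂ := by field_simp
    have eS : p 0 = (p 0 - P.b₁ * (p 1 / P.b₂)) / P.aLen * P.aLen + p 1 / P.b₂ * P.b₁ := by
      field_simp; ring
    set s := (p 0 - P.b₁ * (p 1 / P.b₂)) / P.aLen with hs
    set t := p 1 / P.b₂ with ht
    rw [abs_le] at hS hT ⊢
    have k1 : P.planarCell p 0 - p 0 = (⌊s⌋ - s) * P.aLen + (⌊t⌋ - t) * P.b₁ := by
      rw [eS]; simp [planarCell, ← hs, ← ht]; ring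
    have k2 : P.planarCell p 1 - p 1 = (⌊t⌋ - t) * P.b₂ := by
      rw [eT]; simp [planarCell, ← ht]; ring
    simp only [cellDiam]
    fin_cases l
    · simp only [Fin.zero_eta, k1]
      constructor <;> nlinarith
    · simp only [Fin.mk_one, k2]
      constructor <;> nlinarith
  · intro x hx
    obtain ⟨i, j, rfl⟩ := (P.mem_planarLattice_iff x).1 hx
    rw [hfib]
    exact (volume_parallelepiped hdet0 _ _).1
  · intro x hx
    obtain ⟨i, j, rfl⟩ := (P.mem_planarLattice_iff x).1 hx
    rw [hfib, (volume_parallelepiped hdet0 _ _).2, hdet, one_div, inv_inv, abs_of_pos]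
    positivity

variable (P : SCDParams) (v : ℤ → E3) (z : E3)

/-- The point of the SCD set in layer `m` with lattice coordinates `i, j`. -/
noncomputable def scdPoint (m : ℤ) (i j : ℤ) : E3 :=
  !₂[v m 0 + Real.cos (m * (-P.angle)) * (i * P.aLen + j * P.b₁ + (z - P.cVec) 0) -
      Real.sin (m * (-P.angle)) * (j * P.b₂ + (z - P.cVec) 1),
    v m 1 + Real.sin (m * (-P.angle)) * (i * P.aLen + j * P.b₁ + (z - P.cVec) 0) +
      Real.cos (m * (-P.angle)) * (j * P.b₂ + (z - P.cVec) 1),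
    z 2 - P.c + m * P.c]

variable {v} in
lemma mem_scdSet_iff (hv : P.IsShift v) (y : E3) :
    y ∈ P.scdSet v z ↔ ∃ m i j : ℤ, y = P.scdPoint v z m i j := by
  have key : ∀ m i j : ℤ, m • P.height + v m + P.rotPow m (i • P.aVec + j • P.bVec - P.cVec) +
      P.rotPow m z = P.scdPoint v z m i j := by
    intro m i j
    have hz := hv.1 m
    ext l
    fin_cases l
    · simp [height, rotPow, aVec, bVec, cVec, scdPoint, aLen]; ring
    · simp [height, rotPow, aVec, bVec, cVec, scdPoint, aLen]; ring
    · simp [height, rotPow, aVec, bVec, cVec, scdPoint, hz]; ring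
  constructor
  · rintro ⟨⟨m, w⟩, ⟨x, ⟨i, j, rfl⟩, hw⟩, rfl⟩
    refine ⟨m, i, j, ?_⟩
    rw [← key]
    simp only at hw
    rw [hw]
  · rintro ⟨m, i, j, rfl⟩
    exact ⟨(m, _), ⟨_, ⟨i, j, rfl⟩, rfl⟩, (key m i j).symm⟩

/-- The `b`-coordinate, relative to the lattice of layer `m`. -/
noncomputable def layerCoordB (m : ℤ) (p : E3) : ℝ :=
  (-Real.sin (m * (-P.angle)) * (p 0 - P.scdPoint v z m 0 0 0) +
    Real.cos (m * (-P.angle)) * (p 1 - P.scdPoint v z m 0 0 1)) / P.b₂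

/-- The `a`-coordinate, relative to the lattice of layer `m`. -/
noncomputable def layerCoordA (m : ℤ) (p : E3) : ℝ :=
  (Real.cos (m * (-P.angle)) * (p 0 - P.scdPoint v z m 0 0 0) +
    Real.sin (m * (-P.angle)) * (p 1 - P.scdPoint v z m 0 0 1) -
      P.b₁ * P.layerCoordB v z m p) / P.aLen

/-- The cell map of the SCD set: round down to the nearest layer below, then round down the
lattice coordinates in that layer. -/
noncomputable def scdCell (p : E3) : E3 :=
  P.scdPoint v z ⌊(p 2 - (z 2 - P.c)) / P.c⌋
    ⌊P.layerCoordA v z ⌊(p 2 - (z 2 - P.c)) / P.c⌋ p⌋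
    ⌊P.layerCoordB v z ⌊(p 2 - (z 2 - P.c)) / P.c⌋ p⌋

lemma scdCell_apply_two (p : E3) :
    P.scdCell v z p 2 = z 2 - P.c + ⌊(p 2 - (z 2 - P.c)) / P.c⌋ * P.c := by
  simp [scdCell, scdPoint]

lemma scdPoint_apply_zero (m i j : ℤ) :
    P.scdPoint v z m i j 0 = P.scdPoint v z m 0 0 0 +
      (Real.cos (m * (-P.angle)) * (i * P.aLen + j * P.b₁) -
        Real.sin (m * (-P.angle)) * (j * P.b₂)) := by
  simp [scdPoint]; ring

lemma scdPoint_apply_one (m i j : ℤ) :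
    P.scdPoint v z m i j 1 = P.scdPoint v z m 0 0 1 +
      (Real.sin (m * (-P.angle)) * (i * P.aLen + j * P.b₁) +
        Real.cos (m * (-P.angle)) * (j * P.b₂)) := by
  simp [scdPoint]; ring

lemma scdPoint_apply_two (m i j : ℤ) : P.scdPoint v z m i j 2 = z 2 - P.c + m * P.c := by
  simp [scdPoint]

lemma layerCoordB_scdPoint (m i j : ℤ) : P.layerCoordB v z m (P.scdPoint v z m i j) = j := by
  have hb := P.b₂_pos
  have h := Real.sin_sq_add_cos_sq (m * (-P.angle))
  rw [layerCoordB, scdPoint_apply_zero P v z m i j, scdPoint_apply_one P v z m i j,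
    div_eq_iff hb.ne']
  linear_combination (j * P.b₂) * h

lemma layerCoordA_scdPoint (m i j : ℤ) : P.layerCoordA v z m (P.scdPoint v z m i j) = i := by
  have ha := P.aLen_pos
  have h := Real.sin_sq_add_cos_sq (m * (-P.angle))
  rw [layerCoordA, layerCoordB_scdPoint, scdPoint_apply_zero P v z m i j,
    scdPoint_apply_one P v z m i j, div_eq_iff ha.ne']
  linear_combination (i * P.aLen + j * P.b₁) * h

lemma apply_zero_eq_layerCoord (m : ℤ) (p : E3) :
    p 0 = P.scdPoint v z m 0 0 0 + (Real.cos (m * (-P.angle)) *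
      (P.layerCoordA v z m p * P.aLen + P.layerCoordB v z m p * P.b₁) -
        Real.sin (m * (-P.angle)) * (P.layerCoordB v z m p * P.b₂)) := by
  have ha := P.aLen_pos
  have hb := P.b₂_pos
  have h := Real.sin_sq_add_cos_sq (m * (-P.angle))
  have e1 : P.layerCoordA v z m p * P.aLen + P.layerCoordB v z m p * P.b₁ =
      Real.cos (m * (-P.angle)) * (p 0 - P.scdPoint v z m 0 0 0) +
        Real.sin (m * (-P.angle)) * (p 1 - P.scdPoint v z m 0 0 1) := by
    rw [layerCoordA, div_mul_cancel₀ _ ha.ne']; ring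
  have e2 : P.layerCoordB v z m p * P.b₂ =
      -Real.sin (m * (-P.angle)) * (p 0 - P.scdPoint v z m 0 0 0) +
        Real.cos (m * (-P.angle)) * (p 1 - P.scdPoint v z m 0 0 1) := by
    rw [layerCoordB, div_mul_cancel₀ _ hb.ne']
  rw [e1, e2]
  linear_combination -(p 0 - P.scdPoint v z m 0 0 0) * h

lemma apply_one_eq_layerCoord (m : ℤ) (p : E3) :
    p 1 = P.scdPoint v z m 0 0 1 + (Real.sin (m * (-P.angle)) *
      (P.layerCoordA v z m p * P.aLen + P.layerCoordB v z m p * P.b₁) +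
        Real.cos (m * (-P.angle)) * (P.layerCoordB v z m p * P.b₂)) := by
  have ha := P.aLen_pos
  have hb := P.b₂_pos
  have h := Real.sin_sq_add_cos_sq (m * (-P.angle))
  have e1 : P.layerCoordA v z m p * P.aLen + P.layerCoordB v z m p * P.b₁ =
      Real.cos (m * (-P.angle)) * (p 0 - P.scdPoint v z m 0 0 0) +
        Real.sin (m * (-P.angle)) * (p 1 - P.scdPoint v z m 0 0 1) := by
    rw [layerCoordA, div_mul_cancel₀ _ ha.ne']; ring
  have e2 : P.layerCoordB v z m p * P.b₂ =
      -Real.sin (m * (-P.angle)) * (p 0 - P.scdPoint v z m 0 0 0) +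
        Real.cos (m * (-P.angle)) * (p 1 - P.scdPoint v z m 0 0 1) := by
    rw [layerCoordB, div_mul_cancel₀ _ hb.ne']
  rw [e1, e2]
  linear_combination -(p 1 - P.scdPoint v z m 0 0 1) * h

/-- The linear part of the coordinates `(layerCoordA, layerCoordB, height / c)` of layer `m`. -/
noncomputable def layerMatrix (m : ℤ) : Matrix (Fin 3) (Fin 3) ℝ :=
  !![Real.cos (m * (-P.angle)) / P.aLen + P.b₁ * Real.sin (m * (-P.angle)) / (P.aLen * P.b₂),
      Real.sin (m * (-P.angle)) / P.aLen - P.b₁ * Real.cos (m * (-P.angle)) / (P.aLen * P.b₂), 0;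
    -Real.sin (m * (-P.angle)) / P.b₂, Real.cos (m * (-P.angle)) / P.b₂, 0;
    0, 0, 1 / P.c]

lemma det_layerMatrix (m : ℤ) : (P.layerMatrix m).det = (P.aLen * P.b₂ * P.c)⁻¹ := by
  have ha := P.aLen_pos
  have hb := P.b₂_pos
  have hc := P.c_pos
  have h := Real.sin_sq_add_cos_sq (m * (-P.angle))
  simp only [layerMatrix, Matrix.det_fin_three, Matrix.of_apply, Matrix.cons_val', Matrix.cons_val,
    Matrix.cons_val_zero, Matrix.cons_val_one]
  generalize Real.sin (m * (-P.angle)) = S at *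
  generalize Real.cos (m * (-P.angle)) = C at *
  field_simp
  linear_combination P.b₂ * h

lemma preimage_scdCell (m i j : ℤ) : P.scdCell v z ⁻¹' {P.scdPoint v z m i j} =
    {p : E3 | ∀ l, (P.layerMatrix m).mulVec p.ofLp l +
      (-(P.layerMatrix m).mulVec (P.scdPoint v z m 0 0).ofLp + ![0, 0, (m : ℝ)]) l ∈
        Set.Ico ((![(i : ℝ), j, m] : Fin 3 → ℝ) l)
          ((![(i : ℝ), j, m] : Fin 3 → ℝ) l + 1)} := by
  have ha := P.aLen_pos
  have hb := P.b₂_pos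
  have hc := P.c_pos
  ext p
  have h0 : (P.layerMatrix m).mulVec p.ofLp 0 +
      -(P.layerMatrix m).mulVec (P.scdPoint v z m 0 0).ofLp 0 = P.layerCoordA v z m p := by
    simp only [layerMatrix, Matrix.mulVec, dotProduct, Fin.sum_univ_three, layerCoordA,
      layerCoordB, Matrix.of_apply, Matrix.cons_val', Matrix.cons_val]
    field_simp
    ring
  have h1 : (P.layerMatrix m).mulVec p.ofLp 1 +
      -(P.layerMatrix m).mulVec (P.scdPoint v z m 0 0).ofLp 1 = P.layerCoordB v z m p := by
    simp only [layerMatrix, Matrix.mulVec, dotProduct, Fin.sum_univ_three,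
      layerCoordB, Matrix.of_apply, Matrix.cons_val', Matrix.cons_val]
    field_simp
    ring
  have h2 : (P.layerMatrix m).mulVec p.ofLp 2 +
      (-(P.layerMatrix m).mulVec (P.scdPoint v z m 0 0).ofLp 2 + m) =
        (p 2 - (z 2 - P.c)) / P.c := by
    simp only [layerMatrix, Matrix.mulVec, dotProduct, Fin.sum_univ_three, Matrix.of_apply,
      Matrix.cons_val', Matrix.cons_val, scdPoint_apply_two]
    field_simp
    ring
  have hall : ∀ Q : Fin 3 → Prop, (∀ l, Q l) ↔ Q 0 ∧ Q 1 ∧ Q 2 := by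
    simp [Fin.forall_fin_succ]
  simp only [Set.mem_preimage, Set.mem_singleton_iff, Set.mem_ofPred_eq, hall,
    Pi.add_apply, Pi.neg_apply, Matrix.cons_val, add_zero, h0, h1, h2, Set.mem_Ico,
    ← Int.floor_eq_iff]
  constructor
  · intro h
    have e2 := congrArg (fun y : E3 => y 2) h
    simp only [scdCell_apply_two, scdPoint_apply_two, add_right_inj] at e2
    have hm : ⌊(p 2 - (z 2 - P.c)) / P.c⌋ = m := by
      exact_mod_cast mul_right_cancel₀ hc.ne' e2
    rw [scdCell, hm] at h
    have eA := congrArg (P.layerCoordA v z m) h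
    have eB := congrArg (P.layerCoordB v z m) h
    rw [layerCoordA_scdPoint, layerCoordA_scdPoint] at eA
    rw [layerCoordB_scdPoint, layerCoordB_scdPoint] at eB
    exact ⟨by exact_mod_cast eA, by exact_mod_cast eB, hm⟩
  · rintro ⟨e0, e1, e2⟩
    rw [scdCell, e2, e0, e1]

variable {v} in
lemma isCellMap_scdCell (hv : P.IsShift v) :
    IsCellMap (P.scdSet v z) (P.aLen * P.b₂ * P.c) P.cellDiam (P.scdCell v z) := by
  have ha := P.aLen_pos
  have hb₁ := P.b₁_pos
  have hb := P.b₂_pos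
  have hc := P.c_pos
  have hdet0 : ∀ m, (P.layerMatrix m).det ≠ 0 := fun m => by rw [det_layerMatrix]; positivity
  refine IsCellMap.of_fibers (by positivity) ?_ ?_ ?_ ?_ ?_
  · have : P.scdSet v z =
        Set.range fun q : ℤ × ℤ × ℤ => P.scdPoint v z q.1 q.2.1 q.2.2 := by
      ext x
      rw [mem_scdSet_iff P z hv]
      simp [eq_comm]
    rw [this]
    exact Set.countable_range _
  · exact fun p => (P.mem_scdSet_iff z hv _).2 ⟨_, _, _, rfl⟩
  · intro p l
    set m := ⌊(p 2 - (z 2 - P.c)) / P.c⌋ with hm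
    have hS := abs_floor_sub_le_one (P.layerCoordA v z m p)
    have hT := abs_floor_sub_le_one (P.layerCoordB v z m p)
    have hU := abs_floor_sub_le_one ((p 2 - (z 2 - P.c)) / P.c)
    have e0 := P.apply_zero_eq_layerCoord v z m p
    have e1 := P.apply_one_eq_layerCoord v z m p
    have e2 : p 2 = z 2 - P.c + (p 2 - (z 2 - P.c)) / P.c * P.c := by field_simp; ring
    set s := P.layerCoordA v z m p with hs
    set t := P.layerCoordB v z m p with ht
    have hsin := Real.abs_sin_le_one (m * (-P.angle))
    have hcos := Real.abs_cos_le_one (m * (-P.angle))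
    have hX : |(⌊s⌋ - s) * P.aLen + (⌊t⌋ - t) * P.b₁| ≤ P.aLen + P.b₁ := by
      refine (abs_add_le _ _).trans ?_
      rw [abs_mul, abs_mul, abs_of_pos ha, abs_of_pos hb₁]
      nlinarith
    have hY : |(⌊t⌋ - t) * P.b₂| ≤ P.b₂ := by
      rw [abs_mul, abs_of_pos hb]
      nlinarith
    have hmul : ∀ {x y Y : ℝ}, |x| ≤ 1 → |y| ≤ Y → |x * y| ≤ Y := by
      intro x y Y h1 h2
      rw [abs_mul]
      nlinarith [abs_nonneg x, abs_nonneg y]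
    simp only [cellDiam]
    fin_cases l
    · have k : P.scdCell v z p 0 - p 0 =
          Real.cos (m * (-P.angle)) * ((⌊s⌋ - s) * P.aLen + (⌊t⌋ - t) * P.b₁) -
            Real.sin (m * (-P.angle)) * ((⌊t⌋ - t) * P.b₂) := by
        conv_lhs => rw [e0, scdCell, scdPoint_apply_zero P v z, ← hm, ← hs, ← ht]
        ring
      simp only [Fin.zero_eta, k]
      refine (abs_sub _ _).trans ?_
      linarith [hmul hcos hX, hmul hsin hY]
    · have k : P.scdCell v z p 1 - p 1 =
          Real.sin (m * (-P.angle)) * ((⌊s⌋ - s) * P.aLen + (⌊t⌋ - t) * P.b₁) +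
            Real.cos (m * (-P.angle)) * ((⌊t⌋ - t) * P.b₂) := by
        conv_lhs => rw [e1, scdCell, scdPoint_apply_one P v z, ← hm, ← hs, ← ht]
        ring
      simp only [Fin.mk_one, k]
      refine (abs_add_le _ _).trans ?_
      linarith [hmul hsin hX, hmul hcos hY]
    · have k : P.scdCell v z p 2 - p 2 = (⌊(p 2 - (z 2 - P.c)) / P.c⌋ -
          (p 2 - (z 2 - P.c)) / P.c) * P.c := by
        rw [scdCell_apply_two]
        field_simp
        ring
      simp only [Fin.reduceFinMk, k]
      rw [abs_mul, abs_of_pos hc]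
      nlinarith
  · intro x hx
    obtain ⟨m, i, j, rfl⟩ := (P.mem_scdSet_iff z hv x).1 hx
    rw [preimage_scdCell]
    exact (volume_parallelepiped (hdet0 m) _ _).1
  · intro x hx
    obtain ⟨m, i, j, rfl⟩ := (P.mem_scdSet_iff z hv x).1 hx
    rw [preimage_scdCell, (volume_parallelepiped (hdet0 m) _ _).2, det_layerMatrix, inv_inv,
      abs_of_pos]
    positivity

/-- Relative to a point of the SCD set, the cell map rounds the height down to a multiple
of `c`. -/
lemma scdCell_sub_apply_two {y : E3} (hv : P.IsShift v) (hy : y ∈ P.scdSet v z) (p : E3) :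
    P.scdCell v z p 2 - y 2 = P.c * ⌊(p 2 - y 2) / P.c⌋ := by
  obtain ⟨m, i, j, rfl⟩ := (P.mem_scdSet_iff z hv y).1 hy
  have hc := P.c_pos
  rw [scdCell_apply_two, scdPoint_apply_two,
    show (p 2 - (z 2 - P.c + m * P.c)) / P.c = (p 2 - (z 2 - P.c)) / P.c - m by
      field_simp; ring, Int.floor_sub_intCast]
  push_cast
  ring

end SCDParams

/-! ### Polynomial weights -/

/-- The polynomially decaying weight `(1 + ‖x‖)⁻ⁿ`. -/
noncomputable def polyWeight {E : Type*} [Norm E] (n : ℕ) (x : E) : ℝ := ((1 + ‖x‖) ^ n)⁻¹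

section PolyWeight

variable {E : Type*} [NormedAddCommGroup E]

lemma polyWeight_pos (n : ℕ) (x : E) : 0 < polyWeight n x := by
  unfold polyWeight; positivity

lemma continuous_polyWeight (n : ℕ) : Continuous (polyWeight n : E → ℝ) := by
  unfold polyWeight
  refine Continuous.inv₀ (by fun_prop) fun x => ?_
  positivity

lemma polyWeight_succ (n : ℕ) (x : E) :
    polyWeight (n + 1) x = polyWeight n x * (1 + ‖x‖)⁻¹ := by
  simp only [polyWeight, pow_succ, mul_inv]

lemma polyWeight_antitone {m n : ℕ} (h : m ≤ n) (x : E) : polyWeight n x ≤ polyWeight m x := by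
  unfold polyWeight
  gcongr
  linarith [norm_nonneg x]

lemma polyWeight_neg (n : ℕ) (x : E) : polyWeight n (-x) = polyWeight n x := by
  simp [polyWeight]

/-- Moving the argument by a bounded distance changes the weight at most by a constant factor. -/
lemma polyWeight_le_mul {d : ℝ} (n : ℕ) {x y : E} (h : ‖x - y‖ ≤ d) :
    polyWeight n x ≤ (1 + d) ^ n * polyWeight n y := by
  have hd : 0 ≤ d := (norm_nonneg _).trans h
  have h1 : ‖y‖ ≤ ‖x‖ + d := by
    have := norm_sub_norm_le y x
    rw [norm_sub_rev] at this
    linarith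
  have h2 : 1 + ‖y‖ ≤ (1 + d) * (1 + ‖x‖) := by nlinarith [norm_nonneg x]
  unfold polyWeight
  rw [← div_eq_mul_inv, inv_eq_one_div, div_le_div_iff₀ (by positivity) (by positivity), one_mul,
    ← mul_pow]
  gcongr

lemma polyWeight_eq_rpow (n : ℕ) (x : E) : polyWeight n x = (1 + ‖x‖) ^ (-(n : ℝ)) := by
  rw [Real.rpow_neg (by positivity), Real.rpow_natCast, polyWeight]

lemma integrable_polyWeight [NormedSpace ℝ E] [FiniteDimensional ℝ E] [MeasurableSpace E]
    [BorelSpace E] (μ : Measure E) [μ.IsAddHaarMeasure] {n : ℕ}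
    (h : Module.finrank ℝ E < n) : Integrable (polyWeight n : E → ℝ) μ := by
  rw [funext (polyWeight_eq_rpow n)]
  exact integrable_one_add_norm (by exact_mod_cast h)

lemma hasTemperateGrowth_of_integrable [MeasurableSpace E] {μ : Measure E} {n : ℕ}
    (h : Integrable (polyWeight n : E → ℝ) μ) : μ.HasTemperateGrowth :=
  ⟨n, by rwa [funext (polyWeight_eq_rpow n)] at h⟩

lemma exists_integrable_polyWeight [MeasurableSpace E] (μ : Measure E)
    [h : μ.HasTemperateGrowth] : ∃ n, Integrable (polyWeight n : E → ℝ) μ := by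
  obtain ⟨n, hn⟩ := h.exists_integrable
  exact ⟨n, by rwa [funext (polyWeight_eq_rpow n)]⟩

lemma SchwartzMap.exists_norm_le_polyWeight [NormedSpace ℝ E] {F : Type*} [NormedAddCommGroup F]
    [NormedSpace ℝ F] (f : 𝓢(E, F)) (n : ℕ) : ∃ C, 0 ≤ C ∧ ∀ x, ‖f x‖ ≤ C * polyWeight n x := by
  refine ⟨2 ^ n * ((Finset.Iic (n, 0)).sup fun m => SchwartzMap.seminorm ℝ m.1 m.2) f,
    by positivity, fun x => ?_⟩
  have h := SchwartzMap.one_add_le_sup_seminorm_apply (𝕜 := ℝ) (m := (n, 0)) le_rfl le_rfl f x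
  rw [norm_iteratedFDeriv_zero] at h
  rw [polyWeight, ← div_eq_mul_inv, le_div_iff₀ (by positivity), mul_comm]
  exact h

end PolyWeight

/-! ### Sums over a set with a cell map -/

namespace IsCellMap

variable {n : ℕ} {S : Set (EuclideanSpace ℝ (Fin n))} {V D : ℝ}
  {ρ : EuclideanSpace ℝ (Fin n) → EuclideanSpace ℝ (Fin n)}

lemma count_restrict_eq (h : IsCellMap S V D ρ) :
    Measure.count.restrict S =
      ENNReal.ofReal V⁻¹ • (volume : Measure (EuclideanSpace ℝ (Fin n))).map ρ := by
  have hV := h.volume_pos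
  rw [h.map_volume, smul_smul, ← ENNReal.ofReal_mul (by positivity), inv_mul_cancel₀ hV.ne']
  simp

/-- A sum over `S` is `V⁻¹` times the integral of the summand composed with the cell map. -/
lemma integral_count {G : Type*} [NormedAddCommGroup G] [NormedSpace ℝ G]
    (h : IsCellMap S V D ρ) {f : EuclideanSpace ℝ (Fin n) → G} (hf : StronglyMeasurable f) :
    ∫ x, f x ∂(Measure.count.restrict S) = V⁻¹ • ∫ p, f (ρ p) := by
  rw [h.count_restrict_eq, integral_smul_measure, integral_map h.measurable.aemeasurable
    hf.aestronglyMeasurable, ENNReal.toReal_ofReal (inv_nonneg.2 h.volume_pos.le)]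

lemma integrable_count_iff {G : Type*} [NormedAddCommGroup G]
    (h : IsCellMap S V D ρ) {f : EuclideanSpace ℝ (Fin n) → G} (hf : StronglyMeasurable f) :
    Integrable f (Measure.count.restrict S) ↔ Integrable fun p => f (ρ p) := by
  have hV := inv_pos.2 h.volume_pos
  rw [h.count_restrict_eq, integrable_smul_measure (by simpa using h.volume_pos)
    ENNReal.ofReal_ne_top, integrable_map_measure hf.aestronglyMeasurable h.measurable.aemeasurable]
  rfl

lemma norm_apply_sub_le (h : IsCellMap S V D ρ) (p : EuclideanSpace ℝ (Fin n)) :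
    ‖ρ p - p‖ ≤ n * D := by
  have h1 : ‖ρ p - p‖ ≤ ∑ i, ‖(ρ p - p) i‖ := by
    rw [EuclideanSpace.norm_eq]
    refine Real.sqrt_le_iff.2 ⟨by positivity, ?_⟩
    exact Finset.sum_sq_le_sq_sum_of_nonneg fun i _ => norm_nonneg _
  refine h1.trans ((Finset.sum_le_sum fun i _ => h.abs_sub_le p i).trans ?_)
  simp

/-- Sums of polynomial weights over all translates of `S` are uniformly bounded. -/
lemma exists_integral_polyWeight_le (h : IsCellMap S V D ρ) {k : ℕ} (hk : n < k) :
    ∃ C : ℝ, 0 ≤ C ∧ ∀ y, Integrable (fun x => polyWeight k (x - y)) (Measure.count.restrict S) ∧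
      ∫ x, polyWeight k (x - y) ∂(Measure.count.restrict S) ≤ C := by
  have hV := h.volume_pos
  have hw : Integrable (polyWeight k : EuclideanSpace ℝ (Fin n) → ℝ) volume :=
    integrable_polyWeight _ (by simpa using hk)
  have hmeas : ∀ y : EuclideanSpace ℝ (Fin n), StronglyMeasurable fun x => polyWeight k (x - y) :=
    fun y => ((continuous_polyWeight k).comp (by fun_prop)).stronglyMeasurable
  have hle : ∀ y p : EuclideanSpace ℝ (Fin n),
      polyWeight k (ρ p - y) ≤ (1 + n * D) ^ k * polyWeight k (p - y) := fun y p =>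
    polyWeight_le_mul k (by simpa using h.norm_apply_sub_le p)
  have hint : ∀ y : EuclideanSpace ℝ (Fin n), Integrable fun p =>
      (1 + n * D) ^ k * polyWeight k (p - y) := fun y => (hw.comp_sub_right y).const_mul _
  have hint' : ∀ y : EuclideanSpace ℝ (Fin n), Integrable fun p => polyWeight k (ρ p - y) :=
    fun y => (hint y).mono' ((hmeas y).comp_measurable h.measurable).aestronglyMeasurable
      (Eventually.of_forall fun p => by
        rw [Real.norm_of_nonneg (polyWeight_pos _ _).le]
        exact hle y p)
  refine ⟨|V⁻¹ * ((1 + n * D) ^ k * ∫ x : EuclideanSpace ℝ (Fin n), polyWeight k x)|,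
    abs_nonneg _, fun y => ⟨?_, ?_⟩⟩
  · exact (h.integrable_count_iff (hmeas y)).2 (hint' y)
  · refine le_trans ?_ (le_abs_self _)
    rw [h.integral_count (hmeas y), smul_eq_mul]
    gcongr
    refine (integral_mono (hint' y) (hint y) (hle y)).trans ?_
    rw [integral_const_mul, integral_sub_right_eq_self (fun x => polyWeight k x)]

end IsCellMap

/-! ### The approximating autocorrelations -/

lemma setIntegral_count_finset {α G : Type*} [MeasurableSpace α] [MeasurableSingletonClass α]
    [NormedAddCommGroup G] [NormedSpace ℝ G] [CompleteSpace G] (A : Finset α) (f : α → G) :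
    ∫ x in (A : Set α), f x ∂Measure.count = ∑ x ∈ A, f x := by
  have h : (Measure.count : Measure α).restrict A = ∑ x ∈ A, Measure.dirac x := by
    classical
    ext s hs
    rw [Measure.restrict_apply hs, Measure.finsetSum_apply]
    simp only [Measure.dirac_apply' _ hs]
    rw [Measure.count_apply (hs.inter A.measurableSet), Finset.sum_indicator_eq_sum_filter]
    simp only [Pi.one_apply, Finset.sum_const, nsmul_eq_mul, mul_one]
    have : s ∩ A = ((A.filter (· ∈ s) : Finset α) : Set α) := by ext; simp [and_comm]
    rw [this, Set.encard_coe_eq_coe_finsetCard]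
    rfl
  rw [h, integral_finsetSum_measure fun i _ => integrable_dirac (by simp)]
  simp

lemma approxAutocorrelation_eq {Λ : Set E3} {r : ℝ} {A : Finset E3}
    (hA : (A : Set E3) = Λ ∩ centredCube 3 r) :
    approxAutocorrelation Λ r =
      ENNReal.ofReal (r ^ 3)⁻¹ • ∑ x ∈ A, ∑ y ∈ A, Measure.dirac (x - y) := by
  unfold approxAutocorrelation
  rw [← hA, ← Finset.sum_product']
  congr 1
  ext s hs
  rw [Measure.sum_apply _ hs, Measure.finsetSum_apply, tsum_fintype, Fintype.sum_prod_type,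
    Finset.sum_product]
  rw [← Finset.sum_coe_sort A fun x => ∑ y ∈ A, (Measure.dirac (x - y) : Measure E3) s]
  refine Finset.sum_congr rfl fun x _ => ?_
  rw [← Finset.sum_coe_sort A fun y => (Measure.dirac ((x : E3) - y) : Measure E3) s]
  rfl

lemma integrable_approxAutocorrelation {Λ : Set E3} {r : ℝ} (hfin : (Λ ∩ centredCube 3 r).Finite)
    {G : Type*} [NormedAddCommGroup G] (f : E3 → G) :
    Integrable f (approxAutocorrelation Λ r) := by
  rw [approxAutocorrelation_eq (A := hfin.toFinset) (by simp)]
  refine Integrable.smul_measure ?_ ENNReal.ofReal_ne_top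
  exact integrable_finsetSum_measure.2 fun i _ =>
    integrable_finsetSum_measure.2 fun j _ => integrable_dirac (by simp)

lemma integral_approxAutocorrelation {Λ : Set E3} {r : ℝ} (hr : 0 ≤ r) {A : Finset E3}
    (hA : (A : Set E3) = Λ ∩ centredCube 3 r)
    {G : Type*} [NormedAddCommGroup G] [NormedSpace ℝ G] [CompleteSpace G] (f : E3 → G) :
    ∫ x, f x ∂(approxAutocorrelation Λ r) = (r ^ 3)⁻¹ • ∑ x ∈ A, ∑ y ∈ A, f (x - y) := by
  rw [approxAutocorrelation_eq hA, integral_smul_measure, ENNReal.toReal_ofReal (by positivity),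
    integral_finsetSum_measure fun i _ => integrable_finsetSum_measure.2 fun j _ =>
      integrable_dirac (by simp)]
  congr 1
  refine Finset.sum_congr rfl fun x _ => ?_
  rw [integral_finsetSum_measure fun i _ => integrable_dirac (by simp)]
  simp

/-! ### Vague convergence against decaying functions -/

/-- A continuous cutoff function: `1` on the ball of radius `N`, `0` outside that of radius
`N + 1`. -/
noncomputable def cutoff {E : Type*} [Norm E] (N : ℕ) (x : E) : ℝ := max 0 (min 1 (N + 1 - ‖x‖))

section Cutoff

variable {E : Type*} [NormedAddCommGroup E]

lemma continuous_cutoff (N : ℕ) : Continuous (cutoff N : E → ℝ) := by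
  unfold cutoff; fun_prop

lemma cutoff_nonneg (N : ℕ) (x : E) : 0 ≤ cutoff N x := le_max_left _ _

lemma cutoff_le_one (N : ℕ) (x : E) : cutoff N x ≤ 1 :=
  max_le zero_le_one (min_le_left _ _)

lemma cutoff_eq_one {N : ℕ} {x : E} (h : ‖x‖ ≤ N) : cutoff N x = 1 := by
  rw [cutoff, min_eq_left (by linarith), max_eq_right zero_le_one]

lemma hasCompactSupport_cutoff [NormedSpace ℝ E] [FiniteDimensional ℝ E] (N : ℕ) :
    HasCompactSupport (cutoff N : E → ℝ) := by
  refine HasCompactSupport.intro (isCompact_closedBall (0 : E) (N + 1)) fun x hx => ?_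
  have : (N : ℝ) + 1 < ‖x‖ := by simpa using hx
  exact max_eq_left ((min_le_right _ _).trans (by linarith))

/-- Where the cutoff function is not `1`, one power of the weight is small. -/
lemma one_sub_cutoff_mul_le (n N : ℕ) (x : E) :
    polyWeight (n + 1) x * (1 - cutoff N x) ≤ (1 + (N : ℝ))⁻¹ * polyWeight n x := by
  rcases le_or_gt ‖x‖ N with h | h
  · rw [cutoff_eq_one h, sub_self, mul_zero]
    have := polyWeight_pos n x
    positivity
  · rw [polyWeight_succ, mul_comm (polyWeight n x)]
    have hw := (polyWeight_pos n x).le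
    calc _ ≤ (1 + ‖x‖)⁻¹ * polyWeight n x * 1 := by
          gcongr; linarith [cutoff_nonneg N x]
      _ ≤ _ := by rw [mul_one]; gcongr

end Cutoff

section Vague

variable {E : Type*} [NormedAddCommGroup E] [NormedSpace ℝ E] [FiniteDimensional ℝ E]
  [MeasurableSpace E] [BorelSpace E] {γs : ℕ → Measure E} {γ : Measure E} {n : ℕ} {C : ℝ}

/-- A bound for the integrals of a weight passes to the vague limit. -/
lemma integrable_polyWeight_of_vague [IsLocallyFiniteMeasure γ]
    (hvague : ∀ f : E → ℝ, Continuous f → HasCompactSupport f →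
      Tendsto (fun k => ∫ x, f x ∂(γs k)) atTop (𝓝 (∫ x, f x ∂γ)))
    (hint : ∀ k, Integrable (polyWeight n : E → ℝ) (γs k))
    (hC : ∀ᶠ k in atTop, ∫ x, polyWeight n x ∂(γs k) ≤ C) :
    Integrable (polyWeight n : E → ℝ) γ ∧ ∫ x, polyWeight n x ∂γ ≤ C := by
  have hcont : ∀ N, Continuous fun x : E => polyWeight n x * cutoff N x := fun N =>
    (continuous_polyWeight n).mul (continuous_cutoff N)
  have hsupp : ∀ N, HasCompactSupport fun x : E => polyWeight n x * cutoff N x := fun N =>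
    (hasCompactSupport_cutoff N).mul_left
  have hnn : ∀ N, ∀ x : E, 0 ≤ polyWeight n x * cutoff N x := fun N x =>
    mul_nonneg (polyWeight_pos n x).le (cutoff_nonneg N x)
  have hbd : ∀ N, ∫ x, polyWeight n x * cutoff N x ∂γ ≤ C := by
    intro N
    refine le_of_tendsto (hvague _ (hcont N) (hsupp N)) ?_
    filter_upwards [hC] with k hk
    refine le_trans (integral_mono_of_nonneg (Eventually.of_forall (hnn N)) (hint k)
      (Eventually.of_forall fun x => ?_)) hk
    exact mul_le_of_le_one_right (polyWeight_pos n x).le (cutoff_le_one N x)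
  have hC0 : 0 ≤ C := (integral_nonneg (hnn 0)).trans (hbd 0)
  have hlim : ∀ x : E, Tendsto (fun N : ℕ => ENNReal.ofReal (polyWeight n x * cutoff N x)) atTop
      (𝓝 (ENNReal.ofReal (polyWeight n x))) := by
    intro x
    refine tendsto_const_nhds.congr' ?_
    filter_upwards [eventually_ge_atTop ⌈‖x‖⌉₊] with N hN
    rw [cutoff_eq_one ((Nat.le_ceil _).trans (by exact_mod_cast hN)), mul_one]
  have hle : ∫⁻ x, ENNReal.ofReal (polyWeight n x) ∂γ ≤ ENNReal.ofReal C := by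
    calc ∫⁻ x, ENNReal.ofReal (polyWeight n x) ∂γ
        = ∫⁻ x, liminf (fun N : ℕ => ENNReal.ofReal (polyWeight n x * cutoff N x)) atTop ∂γ :=
          lintegral_congr fun x => (hlim x).liminf_eq.symm
      _ ≤ liminf (fun N : ℕ => ∫⁻ x, ENNReal.ofReal (polyWeight n x * cutoff N x) ∂γ) atTop :=
          lintegral_liminf_le fun N => (hcont N).measurable.ennreal_ofReal
      _ ≤ ENNReal.ofReal C := by
          refine liminf_le_of_le (by isBoundedDefault) fun b hb => ?_
          obtain ⟨N, hN⟩ := hb.exists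
          refine hN.trans ?_
          rw [← ofReal_integral_eq_lintegral_ofReal
            ((hcont N).integrable_of_hasCompactSupport (hsupp N)) (Eventually.of_forall (hnn N))]
          exact ENNReal.ofReal_le_ofReal (hbd N)
  have hI : Integrable (polyWeight n : E → ℝ) γ := by
    refine ⟨(continuous_polyWeight n).aestronglyMeasurable, ?_⟩
    rw [hasFiniteIntegral_iff_ofReal (Eventually.of_forall fun x => (polyWeight_pos n x).le)]
    exact hle.trans_lt ENNReal.ofReal_lt_top
  refine ⟨hI, ?_⟩
  rw [← ENNReal.ofReal_le_ofReal_iff hC0, ofReal_integral_eq_lintegral_ofReal hI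
    (Eventually.of_forall fun x => (polyWeight_pos n x).le)]
  exact hle

/-- Vague convergence extends to continuous functions that decay faster than a weight whose
integrals stay bounded. -/
lemma tendsto_integral_of_vague [IsLocallyFiniteMeasure γ]
    (hvague : ∀ f : E → ℝ, Continuous f → HasCompactSupport f →
      Tendsto (fun k => ∫ x, f x ∂(γs k)) atTop (𝓝 (∫ x, f x ∂γ)))
    (hint : ∀ k, Integrable (polyWeight n : E → ℝ) (γs k))
    (hC : ∀ᶠ k in atTop, ∫ x, polyWeight n x ∂(γs k) ≤ C)
    {f : E → ℂ} (hf : Continuous f) {A : ℝ} (hA0 : 0 ≤ A)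
    (hA : ∀ x, ‖f x‖ ≤ A * polyWeight (n + 1) x) :
    Tendsto (fun k => ∫ x, f x ∂(γs k)) atTop (𝓝 (∫ x, f x ∂γ)) := by
  obtain ⟨hγ, hγC⟩ := integrable_polyWeight_of_vague hvague hint hC
  have hC0 : 0 ≤ C := (integral_nonneg fun x => (polyWeight_pos n x).le).trans hγC
  have hcont : ∀ N, Continuous fun x : E => (cutoff N x : ℂ) * f x := fun N =>
    (Complex.continuous_ofReal.comp (continuous_cutoff N)).mul hf
  have hsupp : ∀ N, HasCompactSupport fun x : E => (cutoff N x : ℂ) * f x := fun N =>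
    ((hasCompactSupport_cutoff N).comp_left Complex.ofReal_zero).mul_right
  have hA' : ∀ x, ‖f x‖ ≤ A * polyWeight n x := fun x =>
    (hA x).trans (by gcongr; exact polyWeight_antitone n.le_succ x)
  have hfint : ∀ {μ : Measure E}, Integrable (polyWeight n : E → ℝ) μ → Integrable f μ :=
    fun h => (h.const_mul A).mono' hf.aestronglyMeasurable (Eventually.of_forall hA')
  have hcint : ∀ (N : ℕ) {μ : Measure E}, Integrable (polyWeight n : E → ℝ) μ →
      Integrable (fun x => (cutoff N x : ℂ) * f x) μ := by
    intro N μ h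
    refine (hfint h).mono (hcont N).aestronglyMeasurable (Eventually.of_forall fun x => ?_)
    rw [norm_mul, Complex.norm_of_nonneg (cutoff_nonneg N x)]
    exact mul_le_of_le_one_left (norm_nonneg _) (cutoff_le_one N x)
  have htail : ∀ (N : ℕ) {μ : Measure E}, Integrable (polyWeight n : E → ℝ) μ →
      ∫ x, polyWeight n x ∂μ ≤ C →
      ‖∫ x, f x ∂μ - ∫ x, (cutoff N x : ℂ) * f x ∂μ‖ ≤ A * C * (1 + (N : ℝ))⁻¹ := by
    intro N μ h hμC
    rw [← integral_sub (hfint h) (hcint N h)]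
    have hb : ∀ x, ‖f x - (cutoff N x : ℂ) * f x‖ ≤ A * (1 + (N : ℝ))⁻¹ * polyWeight n x := by
      intro x
      have e : f x - (cutoff N x : ℂ) * f x = ((1 - cutoff N x : ℝ) : ℂ) * f x := by
        push_cast; ring
      have h1 : 0 ≤ 1 - cutoff N x := sub_nonneg.2 (cutoff_le_one N x)
      rw [e, norm_mul, Complex.norm_of_nonneg h1]
      calc _ ≤ (1 - cutoff N x) * (A * polyWeight (n + 1) x) := by gcongr; exact hA x
        _ = A * (polyWeight (n + 1) x * (1 - cutoff N x)) := by ring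
        _ ≤ A * ((1 + (N : ℝ))⁻¹ * polyWeight n x) :=
            mul_le_mul_of_nonneg_left (one_sub_cutoff_mul_le n N x) hA0
        _ = _ := by ring
    refine (norm_integral_le_of_norm_le (h.const_mul _) (Eventually.of_forall hb)).trans ?_
    rw [integral_const_mul]
    calc _ ≤ A * (1 + (N : ℝ))⁻¹ * C := by gcongr
      _ = _ := by ring
  have hcc : ∀ g : E → ℂ, Continuous g → HasCompactSupport g →
      (∀ k, Integrable g (γs k)) → Integrable g γ →
      Tendsto (fun k => ∫ x, g x ∂(γs k)) atTop (𝓝 (∫ x, g x ∂γ)) := by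
    intro g hg hgs hi hiγ
    have hre := hvague (fun x => (g x).re) (by fun_prop) (hgs.comp_left Complex.zero_re)
    have him := hvague (fun x => (g x).im) (by fun_prop) (hgs.comp_left Complex.zero_im)
    have e : ∀ {μ : Measure E}, Integrable g μ →
        ∫ x, g x ∂μ = ((∫ x, (g x).re ∂μ : ℝ) : ℂ) + ((∫ x, (g x).im ∂μ : ℝ) : ℂ) * Complex.I :=
      fun h => (integral_re_add_im h).symm
    rw [e hiγ]
    simp_rw [fun k => e (hi k)]
    exact ((Complex.continuous_ofReal.tendsto _).comp hre).add
      (((Complex.continuous_ofReal.tendsto _).comp him).mul_const _)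
  rw [Metric.tendsto_nhds]
  intro ε hε
  have hsmall : Tendsto (fun N : ℕ => A * C * (1 + (N : ℝ))⁻¹) atTop (𝓝 (A * C * 0)) := by
    refine Tendsto.const_mul _ ?_
    have := tendsto_one_div_add_atTop_nhds_zero_nat (𝕜 := ℝ)
    simpa [add_comm] using this
  rw [mul_zero] at hsmall
  obtain ⟨N, hN⟩ := (hsmall.eventually_lt_const (show 0 < ε / 3 by positivity)).exists
  have hmain := hcc _ (hcont N) (hsupp N) (fun k => hcint N (hint k)) (hcint N hγ)
  filter_upwards [Metric.tendsto_nhds.1 hmain (ε / 3) (by positivity), hC] with k hk hkC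
  rw [dist_eq_norm] at hk ⊢
  have h1 := htail N (hint k) hkC
  have h2 := htail N hγ hγC
  calc ‖∫ x, f x ∂(γs k) - ∫ x, f x ∂γ‖
      = ‖(∫ x, f x ∂(γs k) - ∫ x, (cutoff N x : ℂ) * f x ∂(γs k)) +
        (∫ x, (cutoff N x : ℂ) * f x ∂(γs k) - ∫ x, (cutoff N x : ℂ) * f x ∂γ) -
        (∫ x, f x ∂γ - ∫ x, (cutoff N x : ℂ) * f x ∂γ)‖ := by congr 1; ring
    _ ≤ _ := (norm_sub_le _ _).trans (add_le_add (norm_add_le _ _) le_rfl)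
    _ < ε := by linarith

end Vague

/-! ### Uniform bounds for the approximating autocorrelations -/

namespace IsCellMap

variable {Λ : Set E3} {V D : ℝ} {ρ : E3 → E3}

/-- The finite set of points of `Λ` in the cube of side length `r`. -/
noncomputable def pointsIn (h : IsCellMap Λ V D ρ) (r : ℝ) : Finset E3 :=
  (h.finite_inter_centredCube r).toFinset

lemma coe_pointsIn (h : IsCellMap Λ V D ρ) (r : ℝ) :
    (h.pointsIn r : Set E3) = Λ ∩ centredCube 3 r := by simp [pointsIn]

lemma mem_pointsIn (h : IsCellMap Λ V D ρ) {r : ℝ} {x : E3} :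
    x ∈ h.pointsIn r ↔ x ∈ Λ ∧ x ∈ centredCube 3 r := by simp [pointsIn]

lemma card_pointsIn (h : IsCellMap Λ V D ρ) (r : ℝ) :
    (h.pointsIn r).card = (Λ ∩ centredCube 3 r).ncard :=
  (Set.ncard_eq_toFinset_card _ _).symm

lemma tendsto_card_pointsIn_sub (h : IsCellMap Λ V D ρ) (s : ℝ) :
    Tendsto (fun r : ℝ => ((h.pointsIn (r - s)).card : ℝ) / r ^ 3) atTop (𝓝 V⁻¹) := by
  simpa only [card_pointsIn] using h.tendsto_ncard_sub s

lemma sum_polyWeight_le (h : IsCellMap Λ V D ρ) {k : ℕ} {C : ℝ} {y : E3}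
    (hC : Integrable (fun x => polyWeight k (x - y)) (Measure.count.restrict Λ) ∧
      ∫ x, polyWeight k (x - y) ∂(Measure.count.restrict Λ) ≤ C) (r : ℝ) :
    ∑ x ∈ h.pointsIn r, polyWeight k (x - y) ≤ C := by
  rw [← setIntegral_count_finset, coe_pointsIn, Set.inter_comm,
    ← Measure.restrict_restrict (measurableSet_centredCube 3 r)]
  exact (setIntegral_le_integral hC.1
    (Eventually.of_forall fun x => (polyWeight_pos k _).le)).trans hC.2

lemma exists_integral_approxAutocorrelation_le (h : IsCellMap Λ V D ρ) {k : ℕ} (hk : 3 < k) :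
    ∃ C : ℝ, 0 ≤ C ∧ ∀ᶠ r in atTop, ∫ x, polyWeight k x ∂(approxAutocorrelation Λ r) ≤ C := by
  obtain ⟨C, hC0, hC⟩ := h.exists_integral_polyWeight_le hk
  have hV := inv_pos.2 h.volume_pos
  refine ⟨(V⁻¹ + 1) * C, by positivity, ?_⟩
  have hd := h.tendsto_card_pointsIn_sub 0
  filter_upwards [hd.eventually_le_const (show V⁻¹ < V⁻¹ + 1 by linarith),
    eventually_gt_atTop 0] with r hr hr0
  rw [sub_zero] at hr
  rw [integral_approxAutocorrelation hr0.le (h.coe_pointsIn r), smul_eq_mul]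
  calc _ ≤ (r ^ 3)⁻¹ * ∑ x ∈ h.pointsIn r, C := by
        gcongr with x hx
        refine le_trans (le_of_eq ?_) (h.sum_polyWeight_le (hC x) r)
        exact Finset.sum_congr rfl fun y _ => by rw [← polyWeight_neg, neg_sub]
    _ = (h.pointsIn r).card / r ^ 3 * C := by
        rw [Finset.sum_const, nsmul_eq_mul]; ring
    _ ≤ _ := by gcongr

/-- The bounds and limits of integrals of decaying functions against an autocorrelation. -/
lemma autocorrelation_tendsto (h : IsCellMap Λ V D ρ) {r : ℕ → ℝ} {γ : Measure E3}
    (hγ : IsAutocorrelation Λ r γ) :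
    Integrable (polyWeight 4 : E3 → ℝ) γ ∧
    ∀ (f : E3 → ℂ) (A : ℝ), Continuous f → 0 ≤ A → (∀ x, ‖f x‖ ≤ A * polyWeight 5 x) →
      Tendsto (fun k => ∫ x, f x ∂(approxAutocorrelation Λ (r k))) atTop (𝓝 (∫ x, f x ∂γ)) := by
  obtain ⟨hr, hlf, hvague⟩ := hγ
  obtain ⟨C, hC0, hC⟩ := h.exists_integral_approxAutocorrelation_le (k := 4) (by norm_num)
  have hint : ∀ k, Integrable (polyWeight 4 : E3 → ℝ) (approxAutocorrelation Λ (r k)) := fun k =>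
    integrable_approxAutocorrelation (h.finite_inter_centredCube _) _
  exact ⟨(integrable_polyWeight_of_vague hvague hint (hr.eventually hC)).1,
    fun f A hf hA0 hA => tendsto_integral_of_vague hvague hint (hr.eventually hC) hf hA0 hA⟩

end IsCellMap

/-! ### Compactness of measures with bounded polynomial moments -/

section Compactness

variable {E : Type*} [NormedAddCommGroup E] [MeasurableSpace E] [BorelSpace E]

/-- Polynomial growth of the masses of balls bounds the integral of a polynomial weight. The
exponent `6 = 4 + 2` makes the sum over the integer radii converge. -/
lemma lintegral_polyWeight_le_of_ball {μ : Measure E} {C : ℝ} (hC : 0 ≤ C)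
    (h : ∀ N : ℕ, μ (Metric.closedBall 0 (N + 1)) ≤ ENNReal.ofReal (C * ((N : ℝ) + 1) ^ 4)) :
    ∫⁻ x, ENNReal.ofReal (polyWeight 6 x) ∂μ ≤
      ENNReal.ofReal (C * ∑' N : ℕ, 1 / ((N : ℝ) + 1) ^ 2) := by
  have hsum : Summable fun N : ℕ => 1 / ((N : ℝ) + 1) ^ 2 := by
    have := (summable_nat_add_iff 1).2 (Real.summable_one_div_nat_pow.2 one_lt_two)
    simpa using this
  have hpt : ∀ x : E, ENNReal.ofReal (polyWeight 6 x) ≤ ∑' N : ℕ,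
      (Metric.closedBall (0 : E) (N + 1)).indicator
        (fun _ => ENNReal.ofReal (1 / ((N : ℝ) + 1) ^ 6)) x := by
    intro x
    refine le_trans ?_ (ENNReal.le_tsum ⌊‖x‖⌋₊)
    have h1 := Nat.lt_floor_add_one ‖x‖
    have h2 := Nat.floor_le (norm_nonneg x)
    rw [Set.indicator_of_mem (by simpa using h1.le)]
    refine ENNReal.ofReal_le_ofReal ?_
    rw [polyWeight, ← one_div]
    gcongr 1 / ?_ ^ 6
    linarith
  calc ∫⁻ x, ENNReal.ofReal (polyWeight 6 x) ∂μ
      ≤ ∫⁻ x, ∑' N : ℕ, (Metric.closedBall (0 : E) (N + 1)).indicator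
        (fun _ => ENNReal.ofReal (1 / ((N : ℝ) + 1) ^ 6)) x ∂μ := lintegral_mono hpt
    _ = ∑' N : ℕ, ENNReal.ofReal (1 / ((N : ℝ) + 1) ^ 6) *
          μ (Metric.closedBall (0 : E) (N + 1)) := by
        rw [lintegral_tsum fun N =>
          (measurable_const.indicator measurableSet_closedBall).aemeasurable]
        refine tsum_congr fun N => ?_
        rw [lintegral_indicator measurableSet_closedBall, setLIntegral_const]
    _ ≤ ∑' N : ℕ, ENNReal.ofReal (C * (1 / ((N : ℝ) + 1) ^ 2)) := by
        refine ENNReal.tsum_le_tsum fun N => ?_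
        refine (mul_le_mul_right (h N) _).trans (le_of_eq ?_)
        rw [← ENNReal.ofReal_mul (by positivity)]
        congr 1
        field_simp
    _ = _ := by
        rw [← tsum_mul_left, ENNReal.ofReal_tsum_of_nonneg (fun N => by positivity)
          (hsum.mul_left C)]

/-- Prokhorov's theorem for measures with a bounded polynomial moment: along an ultrafilter the
measures converge against all functions with one more power of decay. -/
lemma exists_limit_measure [NormedSpace ℝ E] [FiniteDimensional ℝ E] {μs : ℕ → Measure E}
    {n : ℕ} {C : ℝ≥0}
    (h : ∀ k, ∫⁻ x, ENNReal.ofReal (polyWeight n x) ∂(μs k) ≤ C) :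
    ∃ (μ : Measure E) (U : Ultrafilter ℕ), (U : Filter ℕ) ≤ atTop ∧
      Integrable (polyWeight (n + 1) : E → ℝ) μ ∧
      ∀ (f : E → ℂ) (A : ℝ), Continuous f → (∀ x, ‖f x‖ ≤ A * polyWeight (n + 1) x) →
        Tendsto (fun k => ∫ x, f x ∂(μs k)) U (𝓝 (∫ x, f x ∂μ)) := by
  have hwm : ∀ m, Measurable (polyWeight m : E → ℝ) := fun m => (continuous_polyWeight m).measurable
  -- Multiplied by `w` the measures are finite and tight: a factor `1 + ‖x‖` of `w` is to spare.
  let w : E → ℝ≥0∞ := fun x => ENNReal.ofReal (polyWeight (n + 1) x)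
  have hw : Measurable w := (hwm _).ennreal_ofReal
  have hmass : ∀ k, (μs k).withDensity w Set.univ ≤ C := by
    intro k
    rw [withDensity_apply _ MeasurableSet.univ, Measure.restrict_univ]
    have hle : ∀ x, w x ≤ ENNReal.ofReal (polyWeight n x) := fun x =>
      ENNReal.ofReal_le_ofReal (polyWeight_antitone n.le_succ x)
    exact (lintegral_mono hle).trans (h k)
  have hfin : ∀ k, IsFiniteMeasure ((μs k).withDensity w) := fun k =>
    ⟨(hmass k).trans_lt ENNReal.coe_lt_top⟩
  let νs : ℕ → FiniteMeasure E := fun k => ⟨(μs k).withDensity w, hfin k⟩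
  let u : ℕ → ℝ≥0 := fun N => C * (1 + (N : ℝ≥0))⁻¹
  have hu : Tendsto u atTop (𝓝 0) := by
    have h1 := (tendsto_one_div_add_atTop_nhds_zero_nat (𝕜 := ℝ)).const_mul (C : ℝ)
    rw [← NNReal.tendsto_coe]
    simpa [u, add_comm] using h1
  have htail : ∀ k N, (νs k) (Metric.closedBall (0 : E) (N : ℕ))ᶜ ≤ u N := by
    intro k N
    rw [← ENNReal.coe_le_coe, FiniteMeasure.ennreal_coeFn_eq_coeFn_toMeasure]
    change (μs k).withDensity w _ ≤ _
    rw [withDensity_apply _ measurableSet_closedBall.compl]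
    have hc : (u N : ℝ≥0∞) = ENNReal.ofReal (1 + (N : ℝ))⁻¹ * C := by
      rw [mul_comm]
      simp only [u, ENNReal.coe_mul]
      congr 1
      rw [ENNReal.ofReal, Real.toNNReal_inv]
      congr 2
      ext
      rw [Real.coe_toNNReal _ (by positivity)]
      simp
    rw [hc]
    refine le_trans ?_ (mul_le_mul_right (h k) _)
    rw [← lintegral_const_mul _ (hwm n).ennreal_ofReal]
    refine le_trans (setLIntegral_mono ((hwm n).ennreal_ofReal.const_mul _) fun x hx => ?_)
      (setLIntegral_le_lintegral _ _)
    have hx' : (N : ℝ) < ‖x‖ := by simpa using hx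
    rw [← ENNReal.ofReal_mul (by positivity)]
    refine ENNReal.ofReal_le_ofReal ?_
    rw [polyWeight_succ, mul_comm]
    have := (polyWeight_pos n x).le
    gcongr
  have hcomp := isCompact_setOfPred_finiteMeasure_mass_le_compl_isCompact_le (E := E) C hu
    (K := fun N : ℕ => Metric.closedBall (0 : E) N) (fun N => isCompact_closedBall _ _)
    (Or.inl inferInstance)
  have hmem : ∀ k, νs k ∈ {μ : FiniteMeasure E | μ.mass ≤ C ∧
      ∀ N : ℕ, μ (Metric.closedBall (0 : E) N)ᶜ ≤ u N} := by
    refine fun k => ⟨?_, htail k⟩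
    rw [← ENNReal.coe_le_coe, FiniteMeasure.ennreal_mass]
    exact hmass k
  let U : Ultrafilter ℕ := Ultrafilter.of atTop
  obtain ⟨ν, -, hν⟩ := isCompact_iff_ultrafilter_le_nhds.1 hcomp (U.map νs)
    (le_principal_iff.2 (Filter.mem_map.2 (Filter.univ_mem' hmem)))
  have hν' : Tendsto νs U (𝓝 ν) := hν
  have hwi : Measurable fun x : E => ENNReal.ofReal (polyWeight (n + 1) x)⁻¹ :=
    (hwm _).inv.ennreal_ofReal
  refine ⟨(ν : Measure E).withDensity fun x => ENNReal.ofReal (polyWeight (n + 1) x)⁻¹, U,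
    Ultrafilter.of_le _, ?_, ?_⟩
  · refine ⟨(hwm _).aestronglyMeasurable, ?_⟩
    rw [hasFiniteIntegral_iff_ofReal (Eventually.of_forall fun x => (polyWeight_pos _ x).le),
      lintegral_withDensity_eq_lintegral_mul _ hwi (hwm _).ennreal_ofReal]
    have : ∀ x : E, ((fun x : E => ENNReal.ofReal (polyWeight (n + 1) x)⁻¹) *
        (fun x : E => ENNReal.ofReal (polyWeight (n + 1) x)) : E → ℝ≥0∞) x = 1 := by
      intro x
      have h0 := polyWeight_pos (n + 1) x
      rw [Pi.mul_apply, ← ENNReal.ofReal_mul (by positivity), inv_mul_cancel₀ h0.ne',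
        ENNReal.ofReal_one]
    rw [lintegral_congr this, lintegral_one]
    exact measure_lt_top _ _
  · intro f A hf hA
    have hcont : Continuous fun x => ((polyWeight (n + 1) x)⁻¹ : ℝ) • f x :=
      (((continuous_polyWeight _).inv₀ fun x => (polyWeight_pos _ x).ne')).smul hf
    have hbd : ∀ x, ‖((polyWeight (n + 1) x)⁻¹ : ℝ) • f x‖ ≤ A := by
      intro x
      have h0 := polyWeight_pos (n + 1) x
      rw [norm_smul, Real.norm_of_nonneg (by positivity), inv_mul_le_iff₀ h0, mul_comm]
      exact hA x
    have key := (FiniteMeasure.tendsto_iff_forall_integral_rclike_tendsto ℂ).1 hν'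
      (BoundedContinuousFunction.ofNormedAddCommGroup _ hcont A hbd)
    have e1 : ∀ k, ∫ x, ((polyWeight (n + 1) x)⁻¹ : ℝ) • f x ∂(νs k : Measure E) =
        ∫ x, f x ∂(μs k) := by
      intro k
      change ∫ x, ((polyWeight (n + 1) x)⁻¹ : ℝ) • f x ∂((μs k).withDensity w) = _
      rw [integral_withDensity_eq_integral_toReal_smul hw (by simp [w])]
      refine integral_congr_ae (Eventually.of_forall fun x => ?_)
      have h0 := polyWeight_pos (n + 1) x
      simp only [w]
      rw [ENNReal.toReal_ofReal h0.le, smul_smul, mul_inv_cancel₀ h0.ne', one_smul]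
    rw [integral_withDensity_eq_integral_toReal_smul hwi (by simp)]
    have e2 : ∀ x : E, (ENNReal.ofReal (polyWeight (n + 1) x)⁻¹).toReal • f x =
        ((polyWeight (n + 1) x)⁻¹ : ℝ) • f x := fun x => by
      rw [ENNReal.toReal_ofReal (inv_nonneg.2 (polyWeight_pos _ x).le)]
    simp_rw [e2]
    simpa only [BoundedContinuousFunction.coe_ofNormedAddCommGroup, e1] using key

end Compactness

/-! ### Diffraction of the approximating autocorrelations -/

/-- The exponential sum of a finite point set. -/
noncomputable def expSum (A : Finset E3) (ξ : E3) : ℂ :=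
  ∑ x ∈ A, Complex.exp ((-2 * Real.pi * inner ℝ ξ x : ℝ) * Complex.I)

lemma continuous_expSum (A : Finset E3) : Continuous (expSum A) := by
  unfold expSum
  refine continuous_finsetSum _ fun x _ => ?_
  fun_prop

lemma norm_expSum_sq (A : Finset E3) (ξ : E3) : ((‖expSum A ξ‖ ^ 2 : ℝ) : ℂ) =
    ∑ x ∈ A, ∑ y ∈ A, Complex.exp ((-2 * Real.pi * inner ℝ ξ (x - y) : ℝ) * Complex.I) := by
  rw [← Complex.normSq_eq_norm_sq, ← Complex.mul_conj, expSum, map_sum, Finset.sum_mul_sum]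
  refine Finset.sum_congr rfl fun x _ => Finset.sum_congr rfl fun y _ => ?_
  rw [← Complex.exp_conj, ← Complex.exp_add, inner_sub_right]
  congr 1
  simp only [map_mul, Complex.conj_ofReal, Complex.conj_I]
  push_cast
  ring

lemma integral_mul_norm_expSum_sq (A : Finset E3) {φ : E3 → ℂ} (hφ : Integrable φ) :
    ∫ ξ, ((‖expSum A ξ‖ ^ 2 : ℝ) : ℂ) * φ ξ = ∑ x ∈ A, ∑ y ∈ A, 𝓕 φ (x - y) := by
  have hint : ∀ w : E3, Integrable fun ξ : E3 =>
      Complex.exp ((-2 * Real.pi * inner ℝ ξ w : ℝ) * Complex.I) * φ ξ := by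
    intro w
    refine hφ.bdd_mul (c := 1) (by fun_prop) (Eventually.of_forall fun ξ => ?_)
    rw [Complex.norm_exp_ofReal_mul_I]
  simp_rw [norm_expSum_sq, Finset.sum_mul]
  rw [integral_finsetSum _ fun x _ => integrable_finsetSum _ fun y _ => hint _]
  refine Finset.sum_congr rfl fun x _ => ?_
  rw [integral_finsetSum _ fun y _ => hint _]
  refine Finset.sum_congr rfl fun y _ => ?_
  rw [Real.fourier_eq']
  rfl

/-- The diffraction measure of the finite point set `A`, normalised by the volume `r ^ 3`. -/
noncomputable def finiteDiffraction (A : Finset E3) (r : ℝ) : Measure E3 :=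
  ENNReal.ofReal (r ^ 3)⁻¹ • volume.withDensity fun ξ => ENNReal.ofReal (‖expSum A ξ‖ ^ 2)

lemma integral_finiteDiffraction {A : Finset E3} {r : ℝ} (hr : 0 ≤ r) {Λ : Set E3}
    (hA : (A : Set E3) = Λ ∩ centredCube 3 r) {φ : E3 → ℂ} (hφ : Integrable φ) :
    ∫ ξ, φ ξ ∂(finiteDiffraction A r) = ∫ x, 𝓕 φ x ∂(approxAutocorrelation Λ r) := by
  have hm : Measurable fun ξ : E3 => ENNReal.ofReal (‖expSum A ξ‖ ^ 2) :=
    ((continuous_expSum A).norm.pow 2).measurable.ennreal_ofReal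
  rw [finiteDiffraction, integral_smul_measure,
    integral_withDensity_eq_integral_toReal_smul hm (by simp),
    integral_approxAutocorrelation hr hA, ENNReal.toReal_ofReal (by positivity),
    ← integral_mul_norm_expSum_sq A hφ]
  congr 2
  ext ξ
  rw [ENNReal.toReal_ofReal (by positivity)]
  simp

lemma exp_neg_le_polyWeight {t : ℝ} (ht : 1 ≤ t) (x : E3) :
    Real.exp (-(t * ‖x‖ ^ 2)) ≤ 16 * polyWeight 4 x := by
  have h1 : Real.exp (-(t * ‖x‖ ^ 2)) ≤ Real.exp (-‖x‖ ^ 2) :=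
    Real.exp_le_exp.2 (by nlinarith [sq_nonneg ‖x‖])
  refine h1.trans ?_
  have h2 := Real.quadratic_le_exp_of_nonneg (sq_nonneg ‖x‖)
  rw [polyWeight, ← div_eq_mul_inv, le_div_iff₀ (by positivity), Real.exp_neg,
    inv_mul_le_iff₀ (Real.exp_pos _)]
  nlinarith [sq_nonneg (‖x‖ - 1), sq_nonneg (‖x‖ ^ 2 - 1), sq_nonneg (‖x‖ ^ 2 - ‖x‖),
    norm_nonneg x]

/-- The masses of balls under the finite diffraction measures, estimated by testing with
Gaussians. -/
lemma finiteDiffraction_closedBall_le {A : Finset E3} {r : ℝ} (hr : 0 ≤ r) {Λ : Set E3}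
    (hA : (A : Set E3) = Λ ∩ centredCube 3 r) {C : ℝ}
    (hC : ∫ x, polyWeight 4 x ∂(approxAutocorrelation Λ r) ≤ C) (N : ℕ) :
    finiteDiffraction A r (Metric.closedBall 0 (N + 1)) ≤
      ENNReal.ofReal ((3 * Real.pi ^ 2 * 16 * C) * ((N : ℝ) + 1) ^ 4) := by
  have hfin : (Λ ∩ centredCube 3 r).Finite := hA ▸ A.finite_toSet
  have hC0 : 0 ≤ C := (integral_nonneg fun x => (polyWeight_pos 4 x).le).trans hC
  -- The width of the Gaussian is the radius of the ball.
  set b : ℝ := (((N : ℝ) + 1) ^ 2)⁻¹ with hb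
  have hb0 : 0 < b := by positivity
  have hb1 : b ≤ 1 := inv_le_one_of_one_le₀ (one_le_pow₀ (by simp))
  have hG : Integrable fun ξ : E3 => Complex.exp (-(b : ℂ) * ‖ξ‖ ^ 2) := by
    simpa using GaussianFourier.integrable_cexp_neg_mul_sq_norm_add (V := E3)
      (b := (b : ℂ)) (by simpa using hb0) 0 0
  have hGr : Integrable fun ξ : E3 => Real.exp (-(b * ‖ξ‖ ^ 2)) := by
    refine hG.norm.congr (Eventually.of_forall fun ξ => ?_)
    simp only [Complex.norm_exp]
    congr 1
    norm_cast
    ring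
  have hGμ : Integrable (fun ξ : E3 => Real.exp (-(b * ‖ξ‖ ^ 2))) (finiteDiffraction A r) := by
    have hm : Measurable fun ξ : E3 => ENNReal.ofReal (‖expSum A ξ‖ ^ 2) :=
      ((continuous_expSum A).norm.pow 2).measurable.ennreal_ofReal
    refine Integrable.smul_measure ?_ ENNReal.ofReal_ne_top
    rw [integrable_withDensity_iff hm (by simp)]
    refine hGr.mul_bdd (c := (A.card : ℝ) ^ 2) ?_ (Eventually.of_forall fun ξ => ?_)
    · exact hm.ennreal_toReal.aestronglyMeasurable
    · rw [ENNReal.toReal_ofReal (by positivity), Real.norm_of_nonneg (by positivity)]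
      gcongr
      refine (norm_sum_le _ _).trans (le_of_eq ?_)
      simp only [Complex.norm_exp_ofReal_mul_I, Finset.sum_const, nsmul_eq_mul, mul_one]
  have hint : ∫ ξ, Real.exp (-(b * ‖ξ‖ ^ 2)) ∂(finiteDiffraction A r) ≤
      (Real.pi ^ 2 * 16 * C) * ((N : ℝ) + 1) ^ 4 := by
    have e1 : ((∫ ξ, Real.exp (-(b * ‖ξ‖ ^ 2)) ∂(finiteDiffraction A r) : ℝ) : ℂ) =
        ∫ x, 𝓕 (fun ξ : E3 => Complex.exp (-(b : ℂ) * ‖ξ‖ ^ 2)) x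
          ∂(approxAutocorrelation Λ r) := by
      rw [← integral_finiteDiffraction hr hA hG, ← integral_complex_ofReal]
      congr 1
      ext ξ
      push_cast
      ring_nf
    have e2 := congrArg norm e1
    rw [Complex.norm_of_nonneg (integral_nonneg fun ξ => (Real.exp_pos _).le)] at e2
    rw [e2]
    have hpt : ∀ x : E3, ‖𝓕 (fun ξ : E3 => Complex.exp (-(b : ℂ) * ‖ξ‖ ^ 2)) x‖ ≤
        (Real.pi ^ 2 * ((N : ℝ) + 1) ^ 4 * 16) * polyWeight 4 x := by
      intro x
      rw [fourier_gaussian_innerProductSpace (by simpa using hb0), norm_mul]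
      have hpib : 1 ≤ Real.pi / b := by
        rw [one_le_div hb0]; linarith [Real.pi_gt_three]
      -- The exponent is `3 / 2`; the base is at least `1`, so the exponent `2` gives a bound.
      have h1 : ‖((Real.pi : ℂ) / b) ^ (Module.finrank ℝ E3 / 2 : ℂ)‖ ≤
          Real.pi ^ 2 * ((N : ℝ) + 1) ^ 4 := by
        rw [← Complex.ofReal_div, Complex.norm_cpow_eq_rpow_re_of_pos (by linarith)]
        have hre : ((Module.finrank ℝ E3 : ℂ) / 2).re ≤ 2 := by
          rw [finrank_euclideanSpace_fin]; norm_num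
        refine (Real.rpow_le_rpow_of_exponent_le hpib hre).trans (le_of_eq ?_)
        rw [hb, div_inv_eq_mul]
        rw [← Nat.cast_ofNat (R := ℝ), Real.rpow_natCast]
        ring
      have h2 : ‖Complex.exp (-(Real.pi : ℂ) ^ 2 * ‖x‖ ^ 2 / b)‖ ≤ 16 * polyWeight 4 x := by
        rw [Complex.norm_exp]
        have e : (-(Real.pi : ℂ) ^ 2 * ‖x‖ ^ 2 / b).re = -((Real.pi ^ 2 / b) * ‖x‖ ^ 2) := by
          norm_cast
          ring
        rw [e]
        refine exp_neg_le_polyWeight ?_ x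
        rw [one_le_div hb0]
        nlinarith [Real.pi_gt_three]
      calc _ ≤ (Real.pi ^ 2 * ((N : ℝ) + 1) ^ 4) * (16 * polyWeight 4 x) := by gcongr
        _ = _ := by ring
    refine (norm_integral_le_of_norm_le ((integrable_approxAutocorrelation hfin _).const_mul _)
      (Eventually.of_forall hpt)).trans ?_
    rw [integral_const_mul]
    calc _ ≤ (Real.pi ^ 2 * ((N : ℝ) + 1) ^ 4 * 16) * C := by gcongr
      _ = _ := by ring
  -- On the ball of radius `N + 1` the Gaussian is at least `e⁻¹ ≥ 1 / 3`.
  have hlow : ∀ ξ ∈ Metric.closedBall (0 : E3) (N + 1),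
      1 ≤ ENNReal.ofReal (3 * Real.exp (-(b * ‖ξ‖ ^ 2))) := by
    intro ξ hξ
    rw [← ENNReal.ofReal_one]
    refine ENNReal.ofReal_le_ofReal ?_
    have h1 : ‖ξ‖ ≤ N + 1 := by simpa using hξ
    have h2 : b * ‖ξ‖ ^ 2 ≤ 1 := by
      rw [hb, inv_mul_le_iff₀ (by positivity), mul_one]
      gcongr
    have h3 : Real.exp (-1) ≤ Real.exp (-(b * ‖ξ‖ ^ 2)) := Real.exp_le_exp.2 (by linarith)
    have h4 : 1 / 3 ≤ Real.exp (-1) := by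
      rw [Real.exp_neg, one_div]
      gcongr
      linarith [Real.exp_one_lt_d9]
    linarith
  calc finiteDiffraction A r (Metric.closedBall 0 (N + 1))
      = ∫⁻ _ in Metric.closedBall (0 : E3) (N + 1), 1 ∂(finiteDiffraction A r) := by simp
    _ ≤ ∫⁻ ξ in Metric.closedBall (0 : E3) (N + 1),
        ENNReal.ofReal (3 * Real.exp (-(b * ‖ξ‖ ^ 2))) ∂(finiteDiffraction A r) :=
        setLIntegral_mono (by fun_prop) hlow
    _ ≤ ∫⁻ ξ, ENNReal.ofReal (3 * Real.exp (-(b * ‖ξ‖ ^ 2))) ∂(finiteDiffraction A r) :=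
        setLIntegral_le_lintegral _ _
    _ = ENNReal.ofReal (3 * ∫ ξ, Real.exp (-(b * ‖ξ‖ ^ 2)) ∂(finiteDiffraction A r)) := by
        rw [← integral_const_mul, ofReal_integral_eq_lintegral_ofReal (hGμ.const_mul 3)
          (Eventually.of_forall fun ξ => by positivity)]
    _ ≤ _ := by
        refine ENNReal.ofReal_le_ofReal ?_
        linarith

/-- Every autocorrelation has a positive measure as its Fourier transform. -/
lemma IsCellMap.exists_fourierTransform {Λ : Set E3} {V D : ℝ} {ρ : E3 → E3}
    (h : IsCellMap Λ V D ρ) {r : ℕ → ℝ} {γ : Measure E3} (hγ : IsAutocorrelation Λ r γ) :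
    ∃ μ : Measure E3, IsFourierTransformOf μ γ := by
  obtain ⟨C, hC0, hC⟩ := h.exists_integral_approxAutocorrelation_le (k := 4) (by norm_num)
  obtain ⟨hγint, hγlim⟩ := h.autocorrelation_tendsto hγ
  obtain ⟨K, hK⟩ := eventually_atTop.1 ((hγ.1.eventually hC).and (hγ.1.eventually_ge_atTop 0))
  have hK1 : ∀ k, ∫ x, polyWeight 4 x ∂(approxAutocorrelation Λ (r (k + K))) ≤ C :=
    fun k => (hK _ (Nat.le_add_left _ _)).1
  have hK0 : ∀ k, 0 ≤ r (k + K) := fun k => (hK _ (Nat.le_add_left _ _)).2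
  let μs : ℕ → Measure E3 := fun k => finiteDiffraction (h.pointsIn (r (k + K))) (r (k + K))
  have hbound : ∀ k, ∫⁻ x, ENNReal.ofReal (polyWeight 6 x) ∂(μs k) ≤
      ((3 * Real.pi ^ 2 * 16 * C) * ∑' N : ℕ, 1 / ((N : ℝ) + 1) ^ 2).toNNReal := fun k =>
    lintegral_polyWeight_le_of_ball (by positivity) fun N =>
      finiteDiffraction_closedBall_le (hK0 k) (h.coe_pointsIn _) (hK1 k) N
  obtain ⟨μ, U, hU, hμint, hμlim⟩ := exists_limit_measure hbound
  refine ⟨μ, hasTemperateGrowth_of_integrable hγint, hasTemperateGrowth_of_integrable hμint, ?_⟩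
  ext φ
  rw [TemperedDistribution.fourier_apply]
  change ∫ x, 𝓕 φ x ∂γ = ∫ ξ, φ ξ ∂μ
  obtain ⟨A, -, hA⟩ := φ.exists_norm_le_polyWeight 7
  have hφ : Continuous (𝓕 φ : 𝓢(E3, ℂ)) := SchwartzMap.continuous _
  obtain ⟨B, hB0, hB⟩ := (𝓕 φ).exists_norm_le_polyWeight 5
  have l1 := hμlim φ A φ.continuous hA
  have l2 := (hγlim _ B hφ hB0 hB).comp (tendsto_add_atTop_nat K)
  refine (tendsto_nhds_unique (l2.mono_left hU) (l1.congr fun k => ?_))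
  rw [integral_finiteDiffraction (hK0 k) (h.coe_pointsIn _) φ.integrable]
  rfl

/-! ### Autocorrelation integrals as mean values -/

namespace IsCellMap

variable {Λ : Set E3} {V D : ℝ} {ρ : E3 → E3}

lemma pointsIn_subset (h : IsCellMap Λ V D ρ) {r s : ℝ} (hrs : r ≤ s) :
    h.pointsIn r ⊆ h.pointsIn s := by
  intro x hx
  rw [mem_pointsIn] at hx ⊢
  exact ⟨hx.1, fun i => (hx.2 i).trans (by linarith)⟩

/-- Truncating a sum over `Λ` to a cube: the error is bounded, and small for centres `y` that are
far from the boundary of the cube. -/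
lemma norm_integral_sub_sum_le (h : IsCellMap Λ V D ρ) {f : E3 → ℂ} (hf : Continuous f)
    {A C : ℝ} (hA0 : 0 ≤ A) (hA : ∀ x, ‖f x‖ ≤ A * polyWeight 5 x) {y : E3}
    (hC : Integrable (fun x => polyWeight 4 (x - y)) (Measure.count.restrict Λ) ∧
      ∫ x, polyWeight 4 (x - y) ∂(Measure.count.restrict Λ) ≤ C) (r R : ℝ) (hR : 0 ≤ R)
    (hy : y ∈ centredCube 3 (r - 2 * R)) :
    ‖∫ x, f (x - y) ∂(Measure.count.restrict Λ) - ∑ x ∈ h.pointsIn r, f (x - y)‖ ≤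
      A * C * (1 + R)⁻¹ := by
  have hm := measurableSet_centredCube 3 r
  have hfint : Integrable (fun x => f (x - y)) (Measure.count.restrict Λ) := by
    refine (hC.1.const_mul A).mono' (by fun_prop) (Eventually.of_forall fun x => ?_)
    exact (hA _).trans (by gcongr; exact polyWeight_antitone (by norm_num) _)
  rw [← setIntegral_count_finset, coe_pointsIn, Set.inter_comm, ← Measure.restrict_restrict hm,
    ← integral_add_compl hm hfint, add_sub_cancel_left]
  have hpt : ∀ᵐ x ∂((Measure.count.restrict Λ).restrict (centredCube 3 r)ᶜ),
      ‖f (x - y)‖ ≤ A * (1 + R)⁻¹ * polyWeight 4 (x - y) := by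
    refine (ae_restrict_mem hm.compl).mono fun x hx => ?_
    have hx' : ∃ i, r / 2 < |x i| := by
      simpa [centredCube] using hx
    obtain ⟨i, hi⟩ := hx'
    have h1 : R ≤ ‖x - y‖ := by
      have h2 := PiLp.norm_apply_le (x - y) i
      have h3 := hy i
      have h4 := abs_sub_abs_le_abs_sub (x i) (y i)
      rw [Real.norm_eq_abs, PiLp.sub_apply] at h2
      linarith
    refine (hA _).trans ?_
    rw [mul_assoc]
    refine mul_le_mul_of_nonneg_left ?_ hA0
    rw [polyWeight_succ, mul_comm]
    have := (polyWeight_pos 4 (x - y)).le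
    gcongr
  refine (norm_integral_le_of_norm_le (hC.1.restrict.const_mul _) hpt).trans ?_
  rw [integral_const_mul]
  have h5 := (setIntegral_le_integral (s := (centredCube 3 r)ᶜ) hC.1
    (Eventually.of_forall fun x => (polyWeight_pos 4 _).le)).trans hC.2
  calc _ ≤ A * (1 + R)⁻¹ * C := by gcongr
    _ = _ := by ring

/-- If the sums of a decaying function `f` over `Λ`, centred at the points of `Λ`, are all within
`δ` of `M`, then the integral of `f` against any autocorrelation is within `V⁻¹ δ` of `V⁻¹ M`. -/
lemma norm_integral_autocorrelation_sub_le (h : IsCellMap Λ V D ρ) {r : ℕ → ℝ} {γ : Measure E3}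
    (hγ : IsAutocorrelation Λ r γ) {f : E3 → ℂ} (hf : Continuous f) {A : ℝ} (hA0 : 0 ≤ A)
    (hA : ∀ x, ‖f x‖ ≤ A * polyWeight 5 x) {M : ℂ} {δ : ℝ}
    (hM : ∀ y ∈ Λ, ‖∫ x, f (x - y) ∂(Measure.count.restrict Λ) - M‖ ≤ δ) :
    ‖∫ x, f x ∂γ - V⁻¹ * M‖ ≤ V⁻¹ * δ := by
  obtain ⟨C, hC0, hC⟩ := h.exists_integral_polyWeight_le (k := 4) (by norm_num)
  have hlim := (h.autocorrelation_tendsto hγ).2 f A hf hA0 hA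
  -- Centres within `R` of the boundary of the cube contribute `O(1)` each and have density zero;
  -- for the others the truncation error is `O(1 / R)`. The limit in `R` comes last.
  have hfin : ∀ (s R : ℝ), 0 < s → 0 ≤ R →
      ‖∫ x, f x ∂(approxAutocorrelation Λ s) - ((h.pointsIn (s - 0)).card / s ^ 3 : ℝ) * M‖ ≤
        ((h.pointsIn (s - 0)).card / s ^ 3) * (δ + A * C * (1 + R)⁻¹) +
        ((h.pointsIn (s - 0)).card / s ^ 3 - (h.pointsIn (s - 2 * R)).card / s ^ 3) * (A * C) := by
    intro s R hs hR
    rw [sub_zero]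
    have hsub := h.pointsIn_subset (show s - 2 * R ≤ s by linarith)
    have hterm : ∀ y ∈ h.pointsIn s, ‖∑ x ∈ h.pointsIn s, f (x - y) - M‖ ≤
        (δ + A * C * (1 + R)⁻¹) + if y ∈ h.pointsIn (s - 2 * R) then 0 else A * C := by
      intro y hy
      have hyΛ := (h.mem_pointsIn.1 hy).1
      have h1 := hM y hyΛ
      have h2 : ‖∫ x, f (x - y) ∂(Measure.count.restrict Λ) - ∑ x ∈ h.pointsIn s, f (x - y)‖ ≤
          A * C * (1 + R)⁻¹ + if y ∈ h.pointsIn (s - 2 * R) then 0 else A * C := by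
        split_ifs with hmem
        · rw [add_zero]
          exact h.norm_integral_sub_sum_le hf hA0 hA (hC y) s R hR (h.mem_pointsIn.1 hmem).2
        · have := h.norm_integral_sub_sum_le hf hA0 hA (hC y) s 0 le_rfl
            (by simpa using (h.mem_pointsIn.1 hy).2)
          simp only [add_zero, inv_one, mul_one] at this
          have : 0 ≤ A * C * (1 + R)⁻¹ := by positivity
          linarith
      have e : ∑ x ∈ h.pointsIn s, f (x - y) - M =
          (∫ x, f (x - y) ∂(Measure.count.restrict Λ) - M) -
          (∫ x, f (x - y) ∂(Measure.count.restrict Λ) - ∑ x ∈ h.pointsIn s, f (x - y)) := by ring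
      rw [e]
      refine (norm_sub_le _ _).trans ?_
      linarith
    have e : ∫ x, f x ∂(approxAutocorrelation Λ s) - ((h.pointsIn s).card / s ^ 3 : ℝ) * M =
        (s ^ 3)⁻¹ • ∑ y ∈ h.pointsIn s, (∑ x ∈ h.pointsIn s, f (x - y) - M) := by
      rw [integral_approxAutocorrelation hs.le (h.coe_pointsIn s), Finset.sum_comm,
        Finset.sum_sub_distrib, Finset.sum_const, smul_sub, nsmul_eq_mul]
      congr 1
      rw [Complex.real_smul]
      push_cast
      ring
    have hite : ∑ y ∈ h.pointsIn s, (if y ∈ h.pointsIn (s - 2 * R) then 0 else A * C) =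
        ((h.pointsIn s).card - (h.pointsIn (s - 2 * R)).card) * (A * C) := by
      rw [Finset.sum_ite, Finset.sum_const_zero, zero_add, Finset.sum_const, nsmul_eq_mul,
        Finset.filter_notMem_eq_sdiff, Finset.card_sdiff_of_subset hsub,
        Nat.cast_sub (Finset.card_le_card hsub)]
    rw [e, norm_smul, Real.norm_of_nonneg (by positivity)]
    calc _ ≤ (s ^ 3)⁻¹ * ∑ y ∈ h.pointsIn s, ((δ + A * C * (1 + R)⁻¹) +
          if y ∈ h.pointsIn (s - 2 * R) then 0 else A * C) := by
          gcongr
          exact (norm_sum_le _ _).trans (Finset.sum_le_sum hterm)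
      _ = _ := by
          rw [Finset.sum_add_distrib, Finset.sum_const, hite, nsmul_eq_mul]
          ring
  have hR : ∀ R : ℕ, ‖∫ x, f x ∂γ - V⁻¹ * M‖ ≤ V⁻¹ * (δ + A * C * (1 + (R : ℝ))⁻¹) := by
    intro R
    have l0 := (h.tendsto_card_pointsIn_sub 0).comp hγ.1
    have l1 := (h.tendsto_card_pointsIn_sub (2 * R)).comp hγ.1
    have lM : Tendsto (fun k => ((((h.pointsIn (r k - 0)).card / r k ^ 3 : ℝ) : ℂ)) * M) atTop
        (𝓝 (((V⁻¹ : ℝ) : ℂ) * M)) :=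
      ((Complex.continuous_ofReal.tendsto _).comp l0).mul_const M
    have lL := (hlim.sub lM).norm
    have lR := (l0.mul_const (δ + A * C * (1 + (R : ℝ))⁻¹)).add
      ((l0.sub l1).mul_const (A * C))
    rw [sub_self, zero_mul, add_zero] at lR
    have hle := le_of_tendsto_of_tendsto lL lR (by
      filter_upwards [hγ.1.eventually_gt_atTop 0] with k hk
      exact hfin (r k) R hk (Nat.cast_nonneg R))
    simpa using hle
  have hlimR : Tendsto (fun R : ℕ => V⁻¹ * (δ + A * C * (1 + (R : ℝ))⁻¹)) atTop
      (𝓝 (V⁻¹ * (δ + A * C * 0))) := by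
    refine Tendsto.const_mul _ (tendsto_const_nhds.add (Tendsto.const_mul _ ?_))
    have := tendsto_one_div_add_atTop_nhds_zero_nat (𝕜 := ℝ)
    simpa [add_comm] using this
  simpa using ge_of_tendsto' hlimR hR

end IsCellMap

/-! ### Product functions on space -/

lemma integral_mul_mul {𝕜 : Type*} [RCLike 𝕜] (F₀ F₁ F₂ : ℝ → 𝕜) :
    ∫ x : E3, F₀ (x 0) * F₁ (x 1) * F₂ (x 2) = (∫ s, F₀ s) * (∫ s, F₁ s) * ∫ s, F₂ s := by
  have h := integral_fintype_prod_volume_eq_prod (𝕜 := 𝕜) (fun i : Fin 3 => ![F₀, F₁, F₂] i)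
  simp only [Fin.prod_univ_three, Matrix.cons_val] at h
  rw [← h]
  exact (PiLp.volume_preserving_ofLp (Fin 3)).integral_comp
    (MeasurableEquiv.toLp 2 (Fin 3 → ℝ)).symm.measurableEmbedding
    (fun y : Fin 3 → ℝ => F₀ (y 0) * F₁ (y 1) * F₂ (y 2))

lemma integrable_mul_mul {𝕜 : Type*} [RCLike 𝕜] {F₀ F₁ F₂ : ℝ → 𝕜} (h₀ : Integrable F₀)
    (h₁ : Integrable F₁) (h₂ : Integrable F₂) :
    Integrable fun x : E3 => F₀ (x 0) * F₁ (x 1) * F₂ (x 2) := by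
  have h := Integrable.fintype_prod (𝕜 := 𝕜) (f := fun i : Fin 3 => ![F₀, F₁, F₂] i)
    (μ := fun _ => volume) (by intro i; fin_cases i <;> simpa)
  simp only [Fin.prod_univ_three, Matrix.cons_val] at h
  exact (PiLp.volume_preserving_ofLp (Fin 3)).integrable_comp_of_integrable h

lemma fourier_mul_mul (F₀ F₁ F₂ : ℝ → ℂ) (w : E3) :
    𝓕 (fun x : E3 => F₀ (x 0) * F₁ (x 1) * F₂ (x 2)) w =
      𝓕 F₀ (w 0) * 𝓕 F₁ (w 1) * 𝓕 F₂ (w 2) := by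
  simp only [Real.fourier_eq']
  rw [← integral_mul_mul]
  congr 1
  ext x
  have e : inner ℝ x w = inner ℝ (x 0) (w 0) + inner ℝ (x 1) (w 1) + inner ℝ (x 2) (w 2) := by
    rw [PiLp.inner_apply, Fin.sum_univ_three]
  rw [e]
  simp only [smul_eq_mul, mul_add, Complex.ofReal_add, add_mul, Complex.exp_add]
  ring

/-! ### Sums over layers and the Poisson summation formula -/

lemma map_floor_volume : (volume : Measure ℝ).map (fun s => ⌊s⌋) = Measure.count := by
  refine Measure.ext_of_singleton fun n => ?_
  rw [Measure.map_apply Int.measurable_floor (measurableSet_singleton n),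
    Int.preimage_floor_singleton, Real.volume_Ico, Measure.count_singleton]
  simp

lemma integral_comp_floor {F : ℤ → ℂ} (hF : Integrable fun s : ℝ => F ⌊s⌋) :
    ∫ s : ℝ, F ⌊s⌋ = ∑' n, F n := by
  have hm : AEMeasurable (fun s : ℝ => ⌊s⌋) volume := Int.measurable_floor.aemeasurable
  have h1 : Integrable F Measure.count := by
    rw [← map_floor_volume, integrable_map_measure (measurable_of_countable F).aestronglyMeasurable
      hm]
    exact hF
  rw [← integral_map (f := F) hm (measurable_of_countable F).aestronglyMeasurable,
    map_floor_volume, integral_countable h1]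
  simp [Measure.real]

section Floor

variable {c : ℝ}

lemma abs_mul_floor_sub_le (hc : 0 < c) (s : ℝ) : |c * ⌊s / c⌋ - s| ≤ c := by
  have h1 := Int.floor_le (s / c)
  have h2 := Int.lt_floor_add_one (s / c)
  rw [le_div_iff₀ hc] at h1
  rw [div_lt_iff₀ hc] at h2
  rw [abs_le]
  constructor <;> linarith

lemma integrable_comp_mul_floor (hc : 0 < c) (Ψ : 𝓢(ℝ, ℂ)) :
    Integrable fun s : ℝ => Ψ (c * ⌊s / c⌋) := by
  obtain ⟨C, hC0, hC⟩ := Ψ.exists_norm_le_polyWeight 2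
  have hw : Integrable (polyWeight 2 : ℝ → ℝ) volume := integrable_polyWeight _ (by simp)
  refine (hw.const_mul (C * (1 + c) ^ 2)).mono' ?_ (Eventually.of_forall fun s => ?_)
  · exact (Ψ.continuous.measurable.comp (by fun_prop)).aestronglyMeasurable
  · refine (hC _).trans ?_
    rw [mul_assoc]
    gcongr
    exact polyWeight_le_mul 2 (abs_mul_floor_sub_le hc s)

/-- Poisson summation: the sum of `𝓕 ψ` over `c ℤ`, written as the integral of a step function,
is the sum of `ψ` over `c⁻¹ ℤ`. -/
lemma integral_fourier_mul_floor (hc : 0 < c) (ψ : 𝓢(ℝ, ℂ)) :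
    ∫ s : ℝ, (𝓕 ψ) (c * ⌊s / c⌋) = ∑' n : ℤ, ψ (c⁻¹ * n) := by
  have hint := integrable_comp_mul_floor hc (𝓕 ψ)
  have h1 : ∫ s : ℝ, (𝓕 ψ) (c * ⌊s / c⌋) = (c : ℂ) * ∑' n : ℤ, (𝓕 ψ) (c * n) := by
    have h2 := Measure.integral_comp_div (fun s : ℝ => (𝓕 ψ) (c * ⌊s⌋)) c
    have h3 : Integrable fun s : ℝ => (fun n : ℤ => (𝓕 ψ) (c * n)) ⌊s⌋ := by
      have := hint.comp_mul_left' hc.ne'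
      simpa [mul_div_cancel_left₀ _ hc.ne'] using this
    rw [h2, abs_of_pos hc, Complex.real_smul]
    exact congrArg _ (integral_comp_floor (F := fun n : ℤ => (𝓕 ψ) (c * n)) h3)
  let e : ℝ ≃L[ℝ] ℝ := ContinuousLinearEquiv.unitsEquivAut ℝ (Units.mk0 c⁻¹ (inv_ne_zero hc.ne'))
  let f : 𝓢(ℝ, ℂ) := SchwartzMap.compCLMOfContinuousLinearEquiv ℂ e ψ
  have hf : ∀ s, f s = ψ (c⁻¹ * s) := by
    intro s
    simp [f, e, mul_comm]
  have hFf : ∀ t : ℝ, (𝓕 f) t = (c : ℂ) * (𝓕 ψ) (c * t) := by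
    intro t
    rw [SchwartzMap.fourier_coe, SchwartzMap.fourier_coe, Real.fourier_eq', Real.fourier_eq']
    have h3 := Measure.integral_comp_inv_mul_left (fun s : ℝ =>
      Complex.exp ((-2 * Real.pi * inner ℝ s (c * t) : ℝ) * Complex.I) • ψ s) c
    rw [abs_of_pos hc, Complex.real_smul] at h3
    rw [← h3]
    congr 1
    ext s
    rw [hf]
    congr 4
    simp
    field_simp
  have hP := f.tsum_eq_tsum_fourier 0
  rw [h1, ← tsum_mul_left]
  simp only [zero_add, hf, hFf, QuotientAddGroup.mk_zero, fourier_eval_zero, mul_one] at hP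
  exact hP.symm

end Floor

/-! ### Averaging over layers -/

/-- A product kernel that is spread out horizontally, on the scale `ε⁻¹`. -/
noncomputable def layerKernel (G Ψ : ℝ → ℂ) (ε : ℝ) (x : E3) : ℂ :=
  (ε * G (ε * x 0)) * (ε * G (ε * x 1)) * Ψ (x 2)

/-- Size of a spread-out function, and its oscillation on intervals of bounded length, which is
smaller by a factor `ε`. -/
lemma SchwartzMap.exists_norm_sub_le (G : 𝓢(ℝ, ℂ)) {D : ℝ} (hD : 0 ≤ D) :
    ∃ K, 0 ≤ K ∧ ∀ ε : ℝ, 0 < ε → ε ≤ 1 → ∀ s t : ℝ, |s - t| ≤ D →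
      ‖(ε : ℂ) * G (ε * s)‖ ≤ K * (ε * polyWeight 2 (ε * t)) ∧
      ‖(ε : ℂ) * G (ε * s) - ε * G (ε * t)‖ ≤ ε * (K * (ε * polyWeight 2 (ε * t))) := by
  obtain ⟨C, hC0, hC⟩ := G.exists_norm_le_polyWeight 2
  obtain ⟨C', hC'0, hC'⟩ := (SchwartzMap.derivCLM ℝ ℂ G).exists_norm_le_polyWeight 2
  refine ⟨max (C * (1 + D) ^ 2) (C' * (1 + D) ^ 2 * D), by positivity,
    fun ε hε hε1 s t hst => ?_⟩
  have hd : |ε * s - ε * t| ≤ ε * D := by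
    rw [← mul_sub, abs_mul, abs_of_pos hε]; gcongr
  have hd' : |ε * s - ε * t| ≤ D := hd.trans (mul_le_of_le_one_left hD hε1)
  have hw := (polyWeight_pos 2 (ε * t)).le
  have hnε : ‖(ε : ℂ)‖ = ε := Complex.norm_of_nonneg hε.le
  constructor
  · rw [norm_mul, hnε]
    calc ε * ‖G (ε * s)‖ ≤ ε * (C * ((1 + D) ^ 2 * polyWeight 2 (ε * t))) := by
          gcongr
          refine (hC _).trans ?_
          gcongr
          exact polyWeight_le_mul 2 hd'
      _ = (C * (1 + D) ^ 2) * (ε * polyWeight 2 (ε * t)) := by ring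
      _ ≤ _ := by gcongr; exact le_max_left _ _
  · have hder : ∀ x ∈ Metric.closedBall (ε * t) D,
        ‖deriv G x‖ ≤ C' * (1 + D) ^ 2 * polyWeight 2 (ε * t) := by
      intro x hx
      have := hC' x
      rw [SchwartzMap.derivCLM_apply] at this
      refine this.trans ?_
      rw [mul_assoc]
      gcongr
      exact polyWeight_le_mul 2 (by simpa [dist_eq_norm] using hx)
    have hmv := (convex_closedBall (ε * t) D).norm_image_sub_le_of_norm_deriv_le
      (𝕜 := ℝ) (f := G) (fun x _ => G.differentiableAt) hder (Metric.mem_closedBall_self hD)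
      (y := ε * s) (by rwa [Metric.mem_closedBall, Real.dist_eq])
    rw [← mul_sub, norm_mul, hnε]
    rw [Real.norm_eq_abs] at hmv
    calc ε * ‖G (ε * s) - G (ε * t)‖
        ≤ ε * (C' * (1 + D) ^ 2 * polyWeight 2 (ε * t) * (ε * D)) := by
          gcongr
          refine hmv.trans ?_
          gcongr
      _ = ε * ((C' * (1 + D) ^ 2 * D) * (ε * polyWeight 2 (ε * t))) := by ring
      _ ≤ _ := by gcongr; exact le_max_right _ _

lemma integral_mul_comp_mul {𝕜 : Type*} [RCLike 𝕜] (F : ℝ → 𝕜) {ε : ℝ} (hε : 0 < ε) :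
    ∫ s : ℝ, (ε : 𝕜) * F (ε * s) = ∫ s, F s := by
  rw [integral_const_mul, Measure.integral_comp_mul_left, abs_of_pos (inv_pos.2 hε),
    RCLike.real_smul_eq_coe_mul, ← mul_assoc, ← RCLike.ofReal_mul, mul_inv_cancel₀ hε.ne']
  simp

lemma integrable_scaled_mul {𝕜 : Type*} [RCLike 𝕜] {F H : ℝ → 𝕜} (hF : Integrable F)
    (hH : Integrable H) {ε : ℝ} (hε : 0 < ε) :
    Integrable fun q : E3 => ((ε : 𝕜) * F (ε * q 0)) * (ε * F (ε * q 1)) * H (q 2) := by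
  have hF' : Integrable fun s : ℝ => (ε : 𝕜) * F (ε * s) :=
    (hF.comp_mul_left' hε.ne').const_mul _
  exact integrable_mul_mul hF' hF' hH

lemma integral_scaled_mul {𝕜 : Type*} [RCLike 𝕜] (F H : ℝ → 𝕜) {ε : ℝ} (hε : 0 < ε) :
    ∫ q : E3, ((ε : 𝕜) * F (ε * q 0)) * (ε * F (ε * q 1)) * H (q 2) =
      (∫ s, F s) ^ 2 * ∫ s, H s := by
  have h := integral_mul_mul (fun s : ℝ => (ε : 𝕜) * F (ε * s)) (fun s => (ε : 𝕜) * F (ε * s)) H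
  rw [integral_mul_comp_mul F hε] at h
  rw [h, sq]

lemma norm_mul_sub_mul_le {R : Type*} [NormedCommRing R] {a₀ a₁ b₀ b₁ : R} {x₀ x₁ d₀ d₁ : ℝ}
    (ha₁ : ‖a₁‖ ≤ x₁) (hb₀ : ‖b₀‖ ≤ x₀) (h₀ : ‖a₀ - b₀‖ ≤ d₀) (h₁ : ‖a₁ - b₁‖ ≤ d₁) :
    ‖a₀ * a₁ - b₀ * b₁‖ ≤ d₀ * x₁ + x₀ * d₁ := by
  have hd₀ := (norm_nonneg _).trans h₀
  have hx₀ := (norm_nonneg _).trans hb₀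
  calc ‖a₀ * a₁ - b₀ * b₁‖ = ‖(a₀ - b₀) * a₁ + b₀ * (a₁ - b₁)‖ := by congr 1; ring
    _ ≤ ‖a₀ - b₀‖ * ‖a₁‖ + ‖b₀‖ * ‖a₁ - b₁‖ :=
        (norm_add_le _ _).trans (add_le_add (norm_mul_le _ _) (norm_mul_le _ _))
    _ ≤ _ := by gcongr

/-- If the heights of the points of `Λ` are a coset of `c ℤ`, and the cells are the layers between
them cut into pieces, then the sums over `Λ` of a horizontally spread-out kernel are nearly
independent of the centre `y ∈ Λ`: on each cell, the kernel is nearly constant horizontally, and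
vertically one samples it at the multiples of `c`. -/
lemma IsCellMap.exists_norm_integral_layerKernel_sub_le {Λ : Set E3} {V D c : ℝ} {ρ : E3 → E3}
    (h : IsCellMap Λ V D ρ) (hc : 0 < c)
    (hρ : ∀ y ∈ Λ, ∀ p, ρ p 2 - y 2 = c * ⌊(p 2 - y 2) / c⌋) (G Ψ : 𝓢(ℝ, ℂ)) :
    ∃ K, ∀ ε : ℝ, 0 < ε → ε ≤ 1 → ∀ y ∈ Λ,
      ‖∫ x, layerKernel G Ψ ε (x - y) ∂(Measure.count.restrict Λ) -
        V⁻¹ * ((∫ s, G s) ^ 2 * ∫ s : ℝ, Ψ (c * ⌊s / c⌋))‖ ≤ K * ε := by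
  have hV := h.volume_pos
  obtain ⟨K, hK0, hK⟩ := G.exists_norm_sub_le (h.diam_nonneg 0)
  have hw : Integrable (polyWeight 2 : ℝ → ℝ) volume := integrable_polyWeight _ (by simp)
  have hfl := integrable_comp_mul_floor hc Ψ
  refine ⟨V⁻¹ * (2 * K ^ 2 * ((∫ s : ℝ, polyWeight 2 s) ^ 2 * ∫ s : ℝ, ‖Ψ (c * ⌊s / c⌋)‖)),
    fun ε hε hε1 y hy => ?_⟩
  -- The kernel with its vertical factor replaced by a step function, and the bound for the error.
  obtain ⟨T, hT⟩ : ∃ T : E3 → ℂ, T = fun q =>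
    ((ε : ℂ) * G (ε * q 0)) * (ε * G (ε * q 1)) * Ψ (c * ⌊q 2 / c⌋) := ⟨_, rfl⟩
  obtain ⟨b, hb⟩ : ∃ b : E3 → ℝ, b = fun q => (ε * polyWeight 2 (ε * q 0)) *
    (ε * polyWeight 2 (ε * q 1)) * ‖Ψ (c * ⌊q 2 / c⌋)‖ := ⟨_, rfl⟩
  have hTint : Integrable T := by rw [hT]; exact integrable_scaled_mul G.integrable hfl hε
  have hbint : Integrable b := by rw [hb]; exact integrable_scaled_mul hw hfl.norm hε
  have hTval : ∫ q, T q = (∫ s, G s) ^ 2 * ∫ s : ℝ, Ψ (c * ⌊s / c⌋) := by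
    rw [hT]; exact integral_scaled_mul G (fun s => Ψ (c * ⌊s / c⌋)) hε
  have hbval : ∫ q, b q = (∫ s : ℝ, polyWeight 2 s) ^ 2 * ∫ s : ℝ, ‖Ψ (c * ⌊s / c⌋)‖ := by
    rw [hb]; exact integral_scaled_mul (𝕜 := ℝ) (polyWeight 2) (fun s => ‖Ψ (c * ⌊s / c⌋)‖) hε
  have hpt : ∀ p, ‖layerKernel G Ψ ε (ρ p - y) - T (p - y)‖ ≤ 2 * K ^ 2 * ε * b (p - y) := by
    intro p
    have hd : ∀ i, |(ρ p - y) i - (p - y) i| ≤ D := fun i => by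
      simpa using h.abs_sub_le p i
    have h0 := hK ε hε hε1 _ _ (hd 0)
    have h1 := hK ε hε hε1 _ _ (hd 1)
    have h0' := (hK ε hε hε1 ((p - y) 0) ((p - y) 0)
      (by simpa using h.diam_nonneg 0)).1
    have e2 : (ρ p - y) 2 = c * ⌊(p - y) 2 / c⌋ := hρ y hy p
    simp only [layerKernel, hT, hb]
    rw [e2, ← sub_mul, norm_mul]
    have hmain := norm_mul_sub_mul_le h1.1 h0' h0.2 h1.2
    calc _ ≤ (2 * K ^ 2 * ε * ((ε * polyWeight 2 (ε * (p - y) 0)) *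
          (ε * polyWeight 2 (ε * (p - y) 1)))) * ‖Ψ (c * ⌊(p - y) 2 / c⌋)‖ :=
          mul_le_mul_of_nonneg_right (hmain.trans (le_of_eq (by ring))) (norm_nonneg _)
      _ = _ := by ring
  have hcont : Continuous (layerKernel G Ψ ε) := by
    unfold layerKernel
    have := G.continuous
    have := Ψ.continuous
    fun_prop
  have hkm : StronglyMeasurable fun x => layerKernel G Ψ ε (x - y) :=
    (hcont.comp (by fun_prop)).stronglyMeasurable
  have hdiff : Integrable fun p => layerKernel G Ψ ε (ρ p - y) - T (p - y) := by
    refine ((hbint.comp_sub_right y).const_mul (2 * K ^ 2 * ε)).mono' ?_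
      (Eventually.of_forall hpt)
    exact (hkm.comp_measurable h.measurable).aestronglyMeasurable.sub
      (hTint.comp_sub_right y).aestronglyMeasurable
  have hkint : Integrable fun p => layerKernel G Ψ ε (ρ p - y) := by
    refine (hdiff.add (hTint.comp_sub_right y)).congr (Eventually.of_forall fun p => ?_)
    exact sub_add_cancel _ _
  rw [h.integral_count hkm, ← hTval, ← integral_sub_right_eq_self T y, Complex.real_smul,
    ← mul_sub, ← integral_sub hkint (hTint.comp_sub_right y), norm_mul,
    Complex.norm_of_nonneg (by positivity)]
  rw [mul_assoc]
  gcongr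
  refine (norm_integral_le_of_norm_le ((hbint.comp_sub_right y).const_mul (2 * K ^ 2 * ε))
    (Eventually.of_forall hpt)).trans (le_of_eq ?_)
  rw [integral_const_mul, integral_sub_right_eq_self b y, hbval]
  ring

/-! ### The Fourier transform on the axis -/

lemma norm_le_sum_abs (x : E3) : ‖x‖ ≤ |x 0| + |x 1| + |x 2| := by
  rw [EuclideanSpace.norm_eq, Fin.sum_univ_three]
  refine Real.sqrt_le_iff.2 ⟨by positivity, ?_⟩
  simp only [Real.norm_eq_abs]
  nlinarith [abs_nonneg (x 0), abs_nonneg (x 1), abs_nonneg (x 2),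
    mul_nonneg (abs_nonneg (x 0)) (abs_nonneg (x 1)),
    mul_nonneg (abs_nonneg (x 0)) (abs_nonneg (x 2)),
    mul_nonneg (abs_nonneg (x 1)) (abs_nonneg (x 2))]

lemma polyWeight_mul_mul_le (m : ℕ) (x : E3) :
    polyWeight m (x 0) * polyWeight m (x 1) * polyWeight m (x 2) ≤ polyWeight m x := by
  simp only [polyWeight, Real.norm_eq_abs]
  rw [← mul_inv, ← mul_inv, ← mul_pow, ← mul_pow]
  have h0 := abs_nonneg (x 0)
  have h1 := abs_nonneg (x 1)
  have h2 := abs_nonneg (x 2)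
  gcongr
  nlinarith [norm_le_sum_abs x, mul_nonneg h0 h1, mul_nonneg h0 h2, mul_nonneg h1 h2,
    mul_nonneg (mul_nonneg h0 h1) h2]

lemma hasCompactSupport_mul_mul {F₀ F₁ F₂ : ℝ → ℂ} (h₀ : HasCompactSupport F₀)
    (h₁ : HasCompactSupport F₁) (h₂ : HasCompactSupport F₂) :
    HasCompactSupport fun x : E3 => F₀ (x 0) * F₁ (x 1) * F₂ (x 2) := by
  have hb : ∀ {F : ℝ → ℂ}, HasCompactSupport F → ∃ R, ∀ s, R < |s| → F s = 0 := by
    intro F hF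
    obtain ⟨R, hR⟩ := hF.isCompact.isBounded.subset_closedBall 0
    refine ⟨R, fun s hs => image_eq_zero_of_notMem_tsupport fun hmem => ?_⟩
    have := hR hmem
    rw [mem_closedBall_zero_iff, Real.norm_eq_abs] at this
    linarith
  obtain ⟨R₀, hR₀⟩ := hb h₀
  obtain ⟨R₁, hR₁⟩ := hb h₁
  obtain ⟨R₂, hR₂⟩ := hb h₂
  refine HasCompactSupport.intro (isCompact_closedBall (0 : E3) (R₀ + R₁ + R₂)) fun x hx => ?_
  have hx' : R₀ + R₁ + R₂ < ‖x‖ := by simpa using hx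
  have := norm_le_sum_abs x
  by_cases c0 : R₀ < |x 0|
  · rw [hR₀ _ c0, zero_mul, zero_mul]
  by_cases c1 : R₁ < |x 1|
  · rw [hR₁ _ c1, mul_zero, zero_mul]
  · rw [hR₂ _ (by linarith), mul_zero]

lemma fourier_comp_div (F : ℝ → ℂ) {ε : ℝ} (hε : 0 < ε) (t : ℝ) :
    𝓕 (fun s => F (s / ε)) t = ε * 𝓕 F (ε * t) := by
  rw [Real.fourier_eq', Real.fourier_eq']
  have h := Measure.integral_comp_div (fun s : ℝ =>
    Complex.exp ((-2 * Real.pi * inner ℝ s (ε * t) : ℝ) * Complex.I) • F s) ε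
  rw [abs_of_pos hε, Complex.real_smul] at h
  rw [← h]
  congr 1
  ext s
  congr 4
  simp
  field_simp

/-- Test functions that concentrate near the axis as `ε → 0`, with their Fourier transforms. -/
lemma exists_axis_testFunction {g ψ : 𝓢(ℝ, ℂ)} (hg : HasCompactSupport g)
    (hψ : HasCompactSupport ψ) {ε : ℝ} (hε : 0 < ε) :
    ∃ φ : 𝓢(E3, ℂ), (∀ x, φ x = g (x 0 / ε) * g (x 1 / ε) * ψ (x 2)) ∧
      ∀ w, (𝓕 φ) w = layerKernel (𝓕 g : 𝓢(ℝ, ℂ)) (𝓕 ψ : 𝓢(ℝ, ℂ)) ε w := by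
  have hgε : HasCompactSupport fun s : ℝ => g (s / ε) := by
    have := hg.comp_homeomorph (Homeomorph.mulRight₀ ε⁻¹ (inv_ne_zero hε.ne'))
    exact this
  have hsupp := hasCompactSupport_mul_mul hgε hgε hψ
  have hg' : ContDiff ℝ (⊤ : ℕ∞) g := g.smooth _
  have hψ' : ContDiff ℝ (⊤ : ℕ∞) ψ := ψ.smooth _
  have hsm : ContDiff ℝ (⊤ : ℕ∞)
      fun x : E3 => g (x 0 / ε) * g (x 1 / ε) * ψ (x 2) := by fun_prop
  refine ⟨hsupp.toSchwartzMap hsm, fun x => rfl, fun w => ?_⟩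
  rw [SchwartzMap.fourier_coe]
  change 𝓕 (fun x : E3 => g (x 0 / ε) * g (x 1 / ε) * ψ (x 2)) w = _
  rw [fourier_mul_mul (fun s => g (s / ε)) (fun s => g (s / ε)) ψ, fourier_comp_div g hε,
    fourier_comp_div g hε]
  rfl

lemma measurableSet_axis : MeasurableSet SCDParams.axis := by
  have h : SCDParams.axis = {x : E3 | x 0 = 0} ∩ {x : E3 | x 1 = 0} := rfl
  rw [h]
  exact (measurableSet_eq_fun (by fun_prop) measurable_const).inter
    (measurableSet_eq_fun (by fun_prop) measurable_const)

lemma SchwartzMap.tendsto_div_one_div (g : 𝓢(ℝ, ℂ)) (s : ℝ) :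
    Tendsto (fun n : ℕ => g (s / (1 / ((n : ℝ) + 1)))) atTop
      (𝓝 (if s = 0 then g 0 else 0)) := by
  split_ifs with hs
  · simp [hs]
  · refine g.tendsto_cocompact.comp ?_
    rw [← Metric.cobounded_eq_cocompact, ← tendsto_norm_atTop_iff_cobounded]
    have h1 : Tendsto (fun n : ℕ => |s| * ((n : ℝ) + 1)) atTop atTop :=
      (tendsto_atTop_add_const_right _ _ tendsto_natCast_atTop_atTop).const_mul_atTop
        (abs_pos.2 hs)
    refine h1.congr fun n => ?_
    rw [div_div_eq_mul_div, div_one, norm_mul, Real.norm_eq_abs, Real.norm_of_nonneg]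
    positivity

/-- Integrals of test functions concentrating near the axis converge to integrals over the
axis. -/
lemma tendsto_integral_axis (μ : Measure E3) [μ.HasTemperateGrowth] (g ψ : 𝓢(ℝ, ℂ))
    (hg : g 0 = 1) :
    Tendsto (fun n : ℕ => ∫ x : E3, g (x 0 / (1 / ((n : ℝ) + 1))) *
      g (x 1 / (1 / ((n : ℝ) + 1))) * ψ (x 2) ∂μ) atTop
      (𝓝 (∫ x in SCDParams.axis, ψ (x 2) ∂μ)) := by
  obtain ⟨m, hm⟩ := exists_integrable_polyWeight μ
  obtain ⟨C, hC0, hC⟩ := g.exists_norm_le_polyWeight m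
  obtain ⟨B, hB0, hB⟩ := ψ.exists_norm_le_polyWeight m
  have hgc := g.continuous
  have hψc := ψ.continuous
  rw [← integral_indicator measurableSet_axis]
  refine tendsto_integral_of_dominated_convergence (fun x => (C * C * B) * polyWeight m x)
    (fun n => ?_) (hm.const_mul _) (fun n => Eventually.of_forall fun x => ?_)
    (Eventually.of_forall fun x => ?_)
  · exact Continuous.aestronglyMeasurable (by fun_prop)
  · have hC' : ∀ s : ℝ, ‖g (s / (1 / ((n : ℝ) + 1)))‖ ≤ C * polyWeight m s := by
      intro s
      have hs : ‖s‖ ≤ ‖s / (1 / ((n : ℝ) + 1))‖ := by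
        have hn : (0 : ℝ) ≤ n := Nat.cast_nonneg n
        rw [div_div_eq_mul_div, div_one, norm_mul,
          Real.norm_of_nonneg (show (0 : ℝ) ≤ n + 1 by positivity)]
        nlinarith [norm_nonneg s]
      refine (hC _).trans ?_
      unfold polyWeight
      gcongr
    rw [norm_mul, norm_mul]
    have p0 := (polyWeight_pos m (x 0)).le
    have p1 := (polyWeight_pos m (x 1)).le
    calc _ ≤ (C * polyWeight m (x 0)) * (C * polyWeight m (x 1)) * (B * polyWeight m (x 2)) := by
          gcongr
          · exact hC' _
          · exact hC' _
          · exact hB _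
      _ = (C * C * B) * (polyWeight m (x 0) * polyWeight m (x 1) * polyWeight m (x 2)) := by ring
      _ ≤ _ := by gcongr; exact polyWeight_mul_mul_le m x
  · have h := ((g.tendsto_div_one_div (x 0)).mul (g.tendsto_div_one_div (x 1))).mul_const (ψ (x 2))
    convert h using 2
    by_cases h0 : x 0 = 0
    · by_cases h1 : x 1 = 0
      · rw [Set.indicator_of_mem (show x ∈ SCDParams.axis from ⟨h0, h1⟩)]
        simp [h0, h1, hg]
      · rw [Set.indicator_of_notMem fun hx : x ∈ SCDParams.axis => h1 hx.2]
        simp [h1]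
    · rw [Set.indicator_of_notMem fun hx : x ∈ SCDParams.axis => h0 hx.1]
      simp [h0]

lemma integral_fourier_eq (g : 𝓢(ℝ, ℂ)) : ∫ s, (𝓕 g) s = g 0 := by
  have h : (𝓕⁻ (𝓕 g)) 0 = g 0 := by rw [FourierTransform.fourierInv_fourier_eq]
  rw [← h, SchwartzMap.fourierInv_coe, Real.fourierInv_eq']
  simp

/-- The integral over the axis of a test function of the height, against the Fourier transform of
an autocorrelation of a layered set. -/
lemma IsCellMap.integral_axis_eq {Λ : Set E3} {V D c : ℝ} {ρ : E3 → E3}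
    (h : IsCellMap Λ V D ρ) (hc : 0 < c)
    (hρ : ∀ y ∈ Λ, ∀ p, ρ p 2 - y 2 = c * ⌊(p 2 - y 2) / c⌋)
    {r : ℕ → ℝ} {γ μ : Measure E3} (hγ : IsAutocorrelation Λ r γ)
    (hμ : IsFourierTransformOf μ γ) {ψ : 𝓢(ℝ, ℂ)} (hψ : HasCompactSupport ψ) :
    ∫ x in SCDParams.axis, ψ (x 2) ∂μ = V⁻¹ * (V⁻¹ * ∑' n : ℤ, ψ (c⁻¹ * n)) := by
  obtain ⟨hγt, hμt, hF⟩ := hμ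
  have hF' : ∀ φ : 𝓢(E3, ℂ), ∫ x, φ x ∂μ = ∫ x, (𝓕 φ) x ∂γ := fun φ =>
    (congrArg (fun T => T φ) hF).symm
  let β : ContDiffBump (0 : ℝ) := ⟨1 / 2, 1, by norm_num, by norm_num⟩
  have hβ : ContDiff ℝ (⊤ : ℕ∞) fun s : ℝ => ((β s : ℝ) : ℂ) :=
    Complex.ofRealCLM.contDiff.comp β.contDiff
  have hβs : HasCompactSupport fun s : ℝ => ((β s : ℝ) : ℂ) :=
    β.hasCompactSupport.comp_left Complex.ofReal_zero
  obtain ⟨g, hg⟩ : ∃ g : 𝓢(ℝ, ℂ), ∀ s, g s = ((β s : ℝ) : ℂ) :=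
    ⟨hβs.toSchwartzMap hβ, fun s => rfl⟩
  have hg0 : g 0 = 1 := by
    rw [hg, β.one_of_mem_closedBall (by simp [β])]
    simp
  have hgs : HasCompactSupport g := by
    have : (g : ℝ → ℂ) = fun s : ℝ => ((β s : ℝ) : ℂ) := funext hg
    rw [this]; exact hβs
  obtain ⟨K, hK⟩ := h.exists_norm_integral_layerKernel_sub_le hc hρ (𝓕 g) (𝓕 ψ)
  rw [integral_fourier_eq, hg0, integral_fourier_mul_floor hc, one_pow, one_mul] at hK
  have hlim := tendsto_integral_axis μ g ψ hg0
  refine tendsto_nhds_unique hlim ?_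
  rw [tendsto_iff_norm_sub_tendsto_zero]
  have hε0 : Tendsto (fun n : ℕ => V⁻¹ * (K * (1 / ((n : ℝ) + 1)))) atTop (𝓝 0) := by
    simpa using (tendsto_one_div_add_atTop_nhds_zero_nat (𝕜 := ℝ)).const_mul K |>.const_mul V⁻¹
  refine squeeze_zero (fun n => norm_nonneg _) (fun n => ?_) hε0
  have hε : (0 : ℝ) < 1 / ((n : ℝ) + 1) := by positivity
  have hε1 : 1 / ((n : ℝ) + 1) ≤ 1 := by
    rw [div_le_one (by positivity)]; linarith [(Nat.cast_nonneg n : (0 : ℝ) ≤ n)]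
  obtain ⟨φ, hφ, hφF⟩ := exists_axis_testFunction hgs hψ hε
  obtain ⟨A, hA0, hA⟩ := (𝓕 φ).exists_norm_le_polyWeight 5
  have hcont : Continuous (𝓕 φ : 𝓢(E3, ℂ)) := SchwartzMap.continuous _
  have hmain := h.norm_integral_autocorrelation_sub_le hγ hcont hA0 hA
    (M := V⁻¹ * ∑' n : ℤ, ψ (c⁻¹ * n)) (δ := K * (1 / ((n : ℝ) + 1))) (fun y hy => by
      simp_rw [hφF]
      exact hK _ hε hε1 y hy)
  rw [← hF' φ] at hmain
  simp_rw [hφ] at hmain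
  exact hmain

/-! ### Measures on the line and on the axis -/

/-- One half of the statement that the integrals of bump functions determine a measure: the bump
functions that are equal to one on exhausting closed balls converge to the indicator of the open
ball. -/
lemma measure_ball_le_of_lintegral_contDiffBump {ν ν' : Measure ℝ}
    (h : ∀ (m : ℝ) (f : ContDiffBump m),
      ∫⁻ s, ENNReal.ofReal (f s) ∂ν = ∫⁻ s, ENNReal.ofReal (f s) ∂ν') (m t : ℝ) :
    ν (Metric.ball m t) ≤ ν' (Metric.ball m t) := by
  rcases le_or_gt t 0 with ht | ht
  · simp [Metric.ball_eq_empty.2 ht]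
  let f : ℕ → ContDiffBump m := fun n => ⟨t * (1 - 1 / ((n : ℝ) + 2)), t, by
      have : 1 / ((n : ℝ) + 2) < 1 := by
        rw [div_lt_one (by positivity)]
        linarith [n.cast_nonneg (α := ℝ)]
      exact mul_pos ht (by linarith), by
      have : 0 < 1 / ((n : ℝ) + 2) := by positivity
      nlinarith⟩
  have hle : ∀ n s, ENNReal.ofReal (f n s) ≤ (Metric.ball m t).indicator 1 s := by
    intro n s
    by_cases hs : s ∈ Metric.ball m t
    · rw [Set.indicator_of_mem hs]
      exact ENNReal.ofReal_le_one.2 (f n).le_one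
    · rw [(f n).zero_of_le_dist (by simpa [f] using hs)]
      simp
  have hlim : ∀ s, (Metric.ball m t).indicator 1 s ≤
      liminf (fun n => ENNReal.ofReal (f n s)) atTop := by
    intro s
    by_cases hs : s ∈ Metric.ball m t
    · rw [Set.indicator_of_mem hs]
      have h1 : Tendsto (fun n : ℕ => t * (1 - 1 / ((n : ℝ) + 2))) atTop (𝓝 (t * (1 - 0))) := by
        refine Tendsto.const_mul _ (tendsto_const_nhds.sub ?_)
        exact tendsto_const_nhds.div_atTop
          (tendsto_atTop_add_const_right _ _ tendsto_natCast_atTop_atTop)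
      rw [sub_zero, mul_one] at h1
      refine le_liminf_of_le (by isBoundedDefault) ?_
      filter_upwards [h1.eventually_const_lt (Metric.mem_ball.1 hs)] with n hn
      rw [(f n).one_of_mem_closedBall (Metric.mem_closedBall.2 hn.le)]
      simp
    · rw [Set.indicator_of_notMem hs]
      exact bot_le
  calc ν (Metric.ball m t) = ∫⁻ s, (Metric.ball m t).indicator 1 s ∂ν :=
        (lintegral_indicator_one measurableSet_ball).symm
    _ ≤ ∫⁻ s, liminf (fun n => ENNReal.ofReal (f n s)) atTop ∂ν := lintegral_mono hlim
    _ ≤ liminf (fun n => ∫⁻ s, ENNReal.ofReal (f n s) ∂ν) atTop :=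
        lintegral_liminf_le fun n => (f n).continuous.measurable.ennreal_ofReal
    _ = liminf (fun n => ∫⁻ s, ENNReal.ofReal (f n s) ∂ν') atTop := by simp_rw [h]
    _ ≤ ∫⁻ s, (Metric.ball m t).indicator 1 s ∂ν' :=
        liminf_le_of_le (by isBoundedDefault) fun b hb => by
          obtain ⟨n, hn⟩ := hb.exists
          exact hn.trans (lintegral_mono (hle n))
    _ = ν' (Metric.ball m t) := lintegral_indicator_one measurableSet_ball

lemma measure_ext_of_lintegral_contDiffBump {ν ν' : Measure ℝ}
    (h : ∀ (m : ℝ) (f : ContDiffBump m),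
      ∫⁻ s, ENNReal.ofReal (f s) ∂ν = ∫⁻ s, ENNReal.ofReal (f s) ∂ν')
    (hfin : ∀ (m : ℝ) (f : ContDiffBump m), ∫⁻ s, ENNReal.ofReal (f s) ∂ν ≠ ∞) : ν = ν' := by
  have : IsLocallyFiniteMeasure ν := by
    refine ⟨fun m => ⟨Metric.ball m 1, Metric.ball_mem_nhds m one_pos, ?_⟩⟩
    let f : ContDiffBump m := ⟨1, 2, by norm_num, by norm_num⟩
    rw [← lintegral_indicator_one measurableSet_ball]
    refine lt_of_le_of_lt (lintegral_mono fun s => ?_) (hfin m f).lt_top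
    by_cases hs : s ∈ Metric.ball m 1
    · rw [f.one_of_mem_closedBall (Metric.ball_subset_closedBall hs)]
      simp [hs]
    · simp [hs]
  refine Real.measure_ext_Ioo_rat fun a b => ?_
  rw [Real.Ioo_eq_ball]
  exact le_antisymm (measure_ball_le_of_lintegral_contDiffBump h _ _)
    (measure_ball_le_of_lintegral_contDiffBump (fun m f => (h m f).symm) _ _)

/-- The embedding of the line as the third coordinate axis. -/
noncomputable def axisEmb (s : ℝ) : E3 := !₂[0, 0, s]

lemma measurable_axisEmb : Measurable axisEmb := by
  unfold axisEmb
  refine (WithLp.measurable_toLp 2 _).comp (measurable_pi_lambda _ fun i => ?_)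
  fin_cases i <;> simp [measurable_id']

lemma axisEmb_apply_two (s : ℝ) : axisEmb s 2 = s := by simp [axisEmb]

lemma axisEmb_injective : Function.Injective axisEmb :=
  Function.LeftInverse.injective (g := fun x : E3 => x 2) axisEmb_apply_two

lemma axisEmb_of_mem_axis {x : E3} (hx : x ∈ SCDParams.axis) : axisEmb (x 2) = x := by
  ext i
  fin_cases i
  · simpa [axisEmb] using hx.1.symm
  · simpa [axisEmb] using hx.2.symm
  · simp [axisEmb]

lemma axisPoints_eq_range (P : SCDParams) :
    P.axisPoints = Set.range fun n : ℤ => axisEmb (P.c⁻¹ * n) := rfl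

lemma axisEmb_mul_intCast_injective (P : SCDParams) :
    Function.Injective fun n : ℤ => axisEmb (P.c⁻¹ * n) := fun m n hmn => by
  have := mul_left_cancel₀ (inv_ne_zero P.c_pos.ne') (axisEmb_injective hmn)
  exact_mod_cast this

lemma diracComb_axisPoints (P : SCDParams) :
    diracComb P.axisPoints = Measure.sum fun n : ℤ => Measure.dirac (axisEmb (P.c⁻¹ * n)) := by
  ext s hs
  rw [diracComb, Measure.sum_apply _ hs, Measure.sum_apply _ hs, axisPoints_eq_range]
  exact tsum_range (fun x : E3 => Measure.dirac x s) (axisEmb_mul_intCast_injective P)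

lemma isUniformlyDiscrete_axisPoints (P : SCDParams) : IsUniformlyDiscrete P.axisPoints := by
  refine ⟨P.c⁻¹, inv_pos.2 P.c_pos, ?_⟩
  rintro _ ⟨m, rfl⟩ _ ⟨n, rfl⟩ hmn
  have hmn' : m ≠ n := fun h => hmn (by rw [h])
  have h1 : (1 : ℝ) ≤ |(m : ℝ) - n| := by
    exact_mod_cast Int.one_le_abs (sub_ne_zero.2 hmn')
  have h2 := PiLp.norm_apply_le ((!₂[0, 0, P.c⁻¹ * m] : E3) - !₂[0, 0, P.c⁻¹ * n]) 2
  have hc := inv_pos.2 P.c_pos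
  rw [dist_eq_norm]
  refine le_trans ?_ h2
  simp only [PiLp.sub_apply, Matrix.cons_val, Real.norm_eq_abs]
  rw [← mul_sub, abs_mul, abs_of_pos hc]
  nlinarith

/-- The Fourier transform of an autocorrelation of a layered set, restricted to the axis. -/
lemma IsCellMap.restrict_axis_eq {Λ : Set E3} {V D c : ℝ} {ρ : E3 → E3}
    (h : IsCellMap Λ V D ρ) (hc : 0 < c)
    (hρ : ∀ y ∈ Λ, ∀ p, ρ p 2 - y 2 = c * ⌊(p 2 - y 2) / c⌋)
    {r : ℕ → ℝ} {γ μ : Measure E3} (hγ : IsAutocorrelation Λ r γ)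
    (hμ : IsFourierTransformOf μ γ) :
    μ.restrict SCDParams.axis = ENNReal.ofReal (V⁻¹ * V⁻¹) •
      Measure.sum fun n : ℤ => Measure.dirac (axisEmb (c⁻¹ * n)) := by
  have hV := h.volume_pos
  have hcoord : Measurable fun x : E3 => x 2 := by fun_prop
  have hbump : ∀ (m : ℝ) (f : ContDiffBump m),
      ∫⁻ s, ENNReal.ofReal (f s) ∂((μ.restrict SCDParams.axis).map fun x => x 2) =
        ENNReal.ofReal (V⁻¹ * V⁻¹ * ∑' n : ℤ, f (c⁻¹ * n)) := by
    intro m f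
    have hfs : HasCompactSupport fun s : ℝ => ((f s : ℝ) : ℂ) :=
      f.hasCompactSupport.comp_left Complex.ofReal_zero
    obtain ⟨ψ, hψ⟩ : ∃ ψ : 𝓢(ℝ, ℂ), ∀ s, ψ s = ((f s : ℝ) : ℂ) :=
      ⟨hfs.toSchwartzMap (Complex.ofRealCLM.contDiff.comp f.contDiff), fun s => rfl⟩
    have hψs : HasCompactSupport ψ := by
      have : (ψ : ℝ → ℂ) = fun s : ℝ => ((f s : ℝ) : ℂ) := funext hψ
      rw [this]; exact hfs
    have key := h.integral_axis_eq hc hρ hγ hμ hψs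
    simp_rw [hψ] at key
    rw [integral_complex_ofReal, ← Complex.ofReal_tsum] at key
    have key' : ∫ x in SCDParams.axis, f (x 2) ∂μ = V⁻¹ * V⁻¹ * ∑' n : ℤ, f (c⁻¹ * n) := by
      rw [mul_assoc]; exact_mod_cast key
    rw [lintegral_map f.continuous.measurable.ennreal_ofReal hcoord, ← key',
      ofReal_integral_eq_lintegral_ofReal ?_ (Eventually.of_forall fun x => f.nonneg)]
    obtain ⟨_, hμt, _⟩ := hμ
    obtain ⟨k, hk⟩ := exists_integrable_polyWeight μ
    obtain ⟨C, hC0, hC⟩ := ψ.exists_norm_le_polyWeight k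
    refine (hk.const_mul C).restrict.mono'
      (f.continuous.measurable.comp hcoord).aestronglyMeasurable ?_
    filter_upwards [ae_restrict_mem measurableSet_axis] with x hx
    have hx2 : ‖x‖ = ‖x 2‖ := by
      rw [EuclideanSpace.norm_eq, Fin.sum_univ_three, hx.1, hx.2]
      simp [Real.sqrt_sq_eq_abs]
    have := hC (x 2)
    rw [hψ, Complex.norm_real] at this
    simpa [polyWeight, hx2] using this
  have hcomb : ∀ (m : ℝ) (f : ContDiffBump m),
      ∫⁻ s, ENNReal.ofReal (f s) ∂(ENNReal.ofReal (V⁻¹ * V⁻¹) •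
        Measure.sum fun n : ℤ => Measure.dirac (c⁻¹ * n)) =
        ENNReal.ofReal (V⁻¹ * V⁻¹ * ∑' n : ℤ, f (c⁻¹ * n)) := by
    intro m f
    have hm := f.continuous.measurable.ennreal_ofReal
    have hfinite : (Function.support fun n : ℤ => f (c⁻¹ * n)).Finite := by
      have hsub : (Function.support fun n : ℤ => f (c⁻¹ * n)) ⊆
          Set.Icc ⌊c * (m - f.rOut)⌋ ⌈c * (m + f.rOut)⌉ := by
        intro n hn
        have hn' : c⁻¹ * (n : ℝ) ∈ Function.support f := hn
        rw [f.support_eq, Real.ball_eq_Ioo] at hn'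
        have e : c * (c⁻¹ * (n : ℝ)) = n := mul_inv_cancel_left₀ hc.ne' _
        constructor
        · have : (⌊c * (m - f.rOut)⌋ : ℝ) ≤ n := (Int.floor_le _).trans
            ((mul_le_mul_of_nonneg_left hn'.1.le hc.le).trans e.le)
          exact_mod_cast this
        · have : (n : ℝ) ≤ ⌈c * (m + f.rOut)⌉ :=
            (e.ge.trans (mul_le_mul_of_nonneg_left hn'.2.le hc.le)).trans (Int.le_ceil _)
          exact_mod_cast this
      exact (Set.finite_Icc _ _).subset hsub
    rw [lintegral_smul_measure, lintegral_sum_measure,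
      ENNReal.ofReal_mul (show 0 ≤ V⁻¹ * V⁻¹ by positivity),
      ENNReal.ofReal_tsum_of_nonneg (fun n => f.nonneg) (summable_of_hasFiniteSupport hfinite)]
    simp_rw [lintegral_dirac' _ hm]
    rfl
  have hline : ((μ.restrict SCDParams.axis).map fun x => x 2) = ENNReal.ofReal (V⁻¹ * V⁻¹) •
      Measure.sum fun n : ℤ => Measure.dirac (c⁻¹ * n) :=
    measure_ext_of_lintegral_contDiffBump (fun m f => (hbump m f).trans (hcomb m f).symm)
      fun m f => by rw [hbump]; exact ENNReal.ofReal_ne_top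
  calc μ.restrict SCDParams.axis
      = (μ.restrict SCDParams.axis).map fun x => axisEmb (x 2) := by
        conv_lhs => rw [← Measure.map_id (μ := μ.restrict SCDParams.axis)]
        refine Measure.map_congr ?_
        filter_upwards [ae_restrict_mem measurableSet_axis] with x hx
        exact (axisEmb_of_mem_axis hx).symm
    _ = ((μ.restrict SCDParams.axis).map fun x => x 2).map axisEmb :=
        (Measure.map_map measurable_axisEmb hcoord).symm
    _ = _ := by
        rw [hline, Measure.map_smul, Measure.map_sum measurable_axisEmb.aemeasurable]
        simp_rw [Measure.map_dirac' measurable_axisEmb]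

theorem theorem2 (P : SCDParams) (v : ℤ → E3) (hv : P.IsShift v)
    (z : E3) (hz : z ∈ interior P.tile)
    (r : ℕ → ℝ) (γ : Measure E3) (hγ : IsAutocorrelation (P.scdSet v z) r γ) :
    IsUniformlyDiscrete P.axisPoints ∧
    ∃ d₂ d₃ : ℝ,
      HasDensity 2 P.planarLattice d₂ ∧ 0 < d₂ ∧
      HasDensity 3 (P.scdSet v z) d₃ ∧ d₃ = P.c⁻¹ * d₂ ∧
      (∃ μ : Measure E3, IsFourierTransformOf μ γ) ∧
      ∀ μ : Measure E3, IsFourierTransformOf μ γ →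
        IsPurePoint (μ.restrict SCDParams.axis) ∧
        μ.restrict SCDParams.axis =
          ENNReal.ofReal (P.c⁻¹ * (d₂ * d₃)) • diracComb P.axisPoints := by
  have hcell := P.isCellMap_scdCell z hv
  refine ⟨isUniformlyDiscrete_axisPoints P, (P.aLen * P.b₂)⁻¹, (P.aLen * P.b₂ * P.c)⁻¹,
    P.isCellMap_planarCell.hasDensity, inv_pos.2 P.isCellMap_planarCell.volume_pos,
    hcell.hasDensity, ?_, hcell.exists_fourierTransform hγ, fun μ hμ => ?_⟩
  · rw [mul_inv, mul_comm]
  have hμ' : μ.restrict SCDParams.axis =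
      ENNReal.ofReal (P.c⁻¹ * ((P.aLen * P.b₂)⁻¹ * (P.aLen * P.b₂ * P.c)⁻¹)) •
        diracComb P.axisPoints := by
    rw [hcell.restrict_axis_eq P.c_pos (fun y hy p => P.scdCell_sub_apply_two v z hv hy p) hγ hμ,
      diracComb_axisPoints]
    congr 2
    rw [mul_inv (P.aLen * P.b₂) P.c]
    ring
  refine ⟨⟨P.axisPoints, fun _ =>
    ENNReal.ofReal (P.c⁻¹ * ((P.aLen * P.b₂)⁻¹ * (P.aLen * P.b₂ * P.c)⁻¹)),
    Set.countable_range _, ?_⟩, hμ'⟩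
  ext s hs
  rw [hμ', diracComb, Measure.smul_apply, Measure.sum_apply _ hs, Measure.sum_apply _ hs,
    smul_eq_mul, ← ENNReal.tsum_mul_left]
  rfl
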